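/- Let $n\ge 2$, let $c_k>0$ ($k=1,\dots,n$) and $0\le a_1\le a_2\le\dots\le a_n<\infty$. Let $N_1,\dots,N_n$ be $n$ disjoint copies of $(0,\infty)$, and let $N=\bigcup_k\overline{N_k}$ be the star-shaped network obtained by identifying the endpoints $0$ of the closed half-axes $\overline{N_k}$. Let $H=\prod_{k=1}^n L^2(N_k)$ (complex-valued functions), with scalar product $(u,v)_H=\sum_k(u_k,v_k)_{L^2(N_k)}$, and let $A:D(A)\to H$ be $$A(u_k)_k=(-c_k\,\partial_x^2u_k+a_ku_k)_k,\qquad D(A)=\Big\{(u_k)_k\in\prod_{k=1}^nH^2(N_k):\ u_i(0)=u_k(0)\ \forall i,k,\ \ \sum_{k=1}^nc_k\,\partial_xu_k(0^+)=0\Big\}.$$ For $\lambda$ in the resolvent set $\rho(A)$ write $R(\lambda,A)=(\lambda I-A)^{-1}$. Let $\sqrt{re^{i\phi}}=\sqrt r\,e^{i\phi/2}$ for $r>0$, $\phi\in[-\pi,\pi)$, and $\sqrt0=0$. For $\lambda\in\mathbb C$ put $$\xi_k(\lambda)=\sqrt{\frac{\lambda-a_k}{c_k}},\qquad s_k(\lambda)=-\frac{\sum_{l\ne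 k}c_l\xi_l(\lambda)}{c_k\xi_k(\lambda)},\qquad w(\lambda)=\pm i\sum_{j=1}^nc_j\xi_j(\lambda),$$ and define $F_\lambda^{\pm,j}:N\to\mathbb C$ on the branches by $$F_{\lambda,j}^{\pm,j}(x)=\cos(\xi_j(\lambda)x)\pm i\,s_j(\lambda)\sin(\xi_j(\lambda)x)\quad(x\in\overline{N_j}),\qquad F_{\lambda,k}^{\pm,j}(x)=\exp(\pm i\xi_k(\lambda)x)\quad(x\in\overline{N_k},\ k\ne j).$$ For $x\in\overline{N_j}$ put $$K(x,x',\lambda)=\begin{cases}\dfrac1{w(\lambda)}F_{\lambda,j}^{\pm,j}(x)\,F_{\lambda,j}^{\pm,j+1}(x'),& x'\in\overline{N_j},\ x'>x,\\[2mm]\dfrac1{w(\lambda)}F_{\lambda,j}^{\pm,j+1}(x)\,F_{\lambda}^{\pm,j}(x'),& x'\in\overline{N_k},\ k\ne j,\ \text{or } x'\in\overline{N_j},\ x'\le x,\end{cases}$$ where everywhere the sign $+$ is chosen if $\operatorname{Im}\lambda>0$ and $-$ if $\operatorname{Im}\lambda\le0$, and the index $j$ is taken modulo $n$ (that is, $j+1=1$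 if $j=n$). **Theorem 3.8.** Let $f\in H$ and let $\lambda\in\rho(A)$ with $\operatorname{Re}\lambda\ge a_1$. Then $w(\lambda)\neq0$ and $\xi_k(\lambda)\ne0$ for all $k$ (so that $K(\cdot,\cdot,\lambda)$ is well defined), for every $x\in N$ the function $x'\mapsto K(x,x',\lambda)f(x')$ is integrable over $N$, and $$[R(\lambda,A)f](x)=\int_NK(x,x',\lambda)f(x')\,dx'\qquad\text{for every }x\in N,$$ where $R(\lambda,A)f$ denotes the representative that is continuous on $N$, and $\int_N=\sum_{k=1}^n\int_{N_k}$. -/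

import Mathlib

open MeasureTheory Set
open scoped ContDiff

noncomputable section

namespace StarNetwork

/-! ### The Hilbert space on the network -/

/-- Complex-valued `L²` of one branch, the branch being identified with `(0, ∞)`. -/
abbrev BranchL2 : Type := Lp ℂ 2 (volume.restrict (Ioi (0 : ℝ)))

/-- The Hilbert space `H = ∏ₖ L²(Nₖ)` with inner product `∑ₖ (uₖ, vₖ)`. -/
abbrev NetL2 (n : ℕ) : Type := PiLp 2 (fun _ : Fin n => BranchL2)

/-- `g` is the weak derivative of `u` on `(0, ∞)`, tested against smooth functions with compact
support in the open half-axis. -/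
def HasWeakDeriv (u g : BranchL2) : Prop :=
  ∀ φ : ℝ → ℝ, ContDiff ℝ ∞ φ → HasCompactSupport φ → tsupport φ ⊆ Ioi 0 →
    ∫ x in Ioi (0 : ℝ), ((deriv φ x : ℝ) : ℂ) * u x
      = - ∫ x in Ioi (0 : ℝ), ((φ x : ℝ) : ℂ) * g x

/-- `u ∈ H²(0, ∞)`: the function `u ∈ L²` has first and second weak derivatives in `L²`. -/
def MemH2 (u : BranchL2) : Prop :=
  ∃ g h : BranchL2, HasWeakDeriv u g ∧ HasWeakDeriv g h

open Classical in
/-- The weak derivative in `L²` (zero if there is none). -/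
def weakDeriv (u : BranchL2) : BranchL2 :=
  if h : ∃ g, HasWeakDeriv u g then h.choose else 0

theorem integrable_test_mul {φ : ℝ → ℝ} (hφ : Continuous φ) (hc : HasCompactSupport φ)
    (u : BranchL2) :
    Integrable (fun x => ((φ x : ℝ) : ℂ) * u x) (volume.restrict (Ioi (0 : ℝ))) := by
  have h1 : MemLp (fun x => ((φ x : ℝ) : ℂ)) 2 (volume.restrict (Ioi (0 : ℝ))) := by
    have : MemLp (fun x => ((φ x : ℝ) : ℂ)) 2 volume := by
      refine Continuous.memLp_of_hasCompactSupport (by fun_prop) ?_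
      exact hc.comp_left (g := fun r : ℝ => (r : ℂ)) (by simp)
    exact this.restrict _
  exact h1.integrable_mul (Lp.memLp u)

theorem HasWeakDeriv.unique {u g g' : BranchL2} (h : HasWeakDeriv u g)
    (h' : HasWeakDeriv u g') : g = g' := by
  have hloc : LocallyIntegrableOn (fun x => g x - g' x) (Ioi (0 : ℝ)) volume := by
    have h2 : LocallyIntegrable (fun x => g x - g' x) (volume.restrict (Ioi (0 : ℝ))) :=
      ((Lp.memLp g).locallyIntegrable (by norm_num)).sub
        ((Lp.memLp g').locallyIntegrable (by norm_num))
    exact locallyIntegrableOn_of_locallyIntegrable_restrict h2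
  have key := IsOpen.ae_eq_zero_of_integral_contDiff_smul_eq_zero (isOpen_Ioi (a := (0 : ℝ)))
    hloc (by
      intro φ h1 h2 h3
      have e : ∫ x in Ioi (0 : ℝ), φ x • (g x - g' x) = 0 := by
        have e1 := h φ h1 h2 h3
        have e2 := h' φ h1 h2 h3
        rw [e1, neg_inj] at e2
        have : (fun x => φ x • (g x - g' x))
            = fun x => ((φ x : ℝ) : ℂ) * g x - ((φ x : ℝ) : ℂ) * g' x := by
          funext x
          rw [Complex.real_smul, mul_sub]
        rw [this, integral_sub (integrable_test_mul h1.continuous h2 g)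
          (integrable_test_mul h1.continuous h2 g'), e2, sub_self]
      rw [setIntegral_eq_integral_of_forall_compl_eq_zero] at e
      · exact e
      · intro x hx
        have : φ x = 0 := by
          by_contra hne
          exact hx (h3 (subset_tsupport φ hne))
        simp [this])
  refine Lp.ext ?_
  rw [Filter.EventuallyEq, ae_restrict_iff' measurableSet_Ioi]
  filter_upwards [key] with x hx hx0
  exact sub_eq_zero.1 (hx hx0)

theorem HasWeakDeriv.weakDeriv_eq {u g : BranchL2} (h : HasWeakDeriv u g) :
    weakDeriv u = g := by
  have hex : ∃ g, HasWeakDeriv u g := ⟨g, h⟩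
  rw [weakDeriv, dif_pos hex]
  exact hex.choose_spec.unique h

theorem hasWeakDeriv_zero : HasWeakDeriv 0 0 := by
  intro φ _ _ _
  have hz := Lp.coeFn_zero ℂ 2 (volume.restrict (Ioi (0 : ℝ)))
  have e1 : ∫ x in Ioi (0 : ℝ), ((deriv φ x : ℝ) : ℂ) * (0 : BranchL2) x = 0 :=
    integral_eq_zero_of_ae (by filter_upwards [hz] with x hx; rw [hx, Pi.zero_apply, mul_zero])
  have e2 : ∫ x in Ioi (0 : ℝ), ((φ x : ℝ) : ℂ) * (0 : BranchL2) x = 0 :=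
    integral_eq_zero_of_ae (by filter_upwards [hz] with x hx; rw [hx, Pi.zero_apply, mul_zero])
  rw [e1, e2, neg_zero]

theorem HasWeakDeriv.add {u g u' g' : BranchL2} (h : HasWeakDeriv u g)
    (h' : HasWeakDeriv u' g') : HasWeakDeriv (u + u') (g + g') := by
  intro φ h1 h2 h3
  have aux : ∀ ψ : ℝ → ℝ, Continuous ψ → HasCompactSupport ψ → ∀ p q : BranchL2,
      ∫ x in Ioi (0 : ℝ), ((ψ x : ℝ) : ℂ) * (p + q : BranchL2) x
        = (∫ x in Ioi (0 : ℝ), ((ψ x : ℝ) : ℂ) * p x)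
          + ∫ x in Ioi (0 : ℝ), ((ψ x : ℝ) : ℂ) * q x := by
    intro ψ hψ hc p q
    rw [← integral_add (integrable_test_mul hψ hc p) (integrable_test_mul hψ hc q)]
    refine integral_congr_ae ?_
    filter_upwards [Lp.coeFn_add p q] with x hx
    rw [hx, Pi.add_apply, mul_add]
  rw [aux _ (h1.continuous_deriv (by simp)) h2.deriv, aux _ h1.continuous h2,
    h φ h1 h2 h3, h' φ h1 h2 h3, neg_add]

theorem HasWeakDeriv.smul {u g : BranchL2} (z : ℂ) (h : HasWeakDeriv u g) :
    HasWeakDeriv (z • u) (z • g) := by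
  intro φ h1 h2 h3
  have aux : ∀ ψ : ℝ → ℝ, ∀ p : BranchL2,
      ∫ x in Ioi (0 : ℝ), ((ψ x : ℝ) : ℂ) * (z • p : BranchL2) x
        = z * ∫ x in Ioi (0 : ℝ), ((ψ x : ℝ) : ℂ) * p x := by
    intro ψ p
    rw [← integral_const_mul]
    refine integral_congr_ae ?_
    filter_upwards [Lp.coeFn_smul z p] with x hx
    rw [hx, Pi.smul_apply, smul_eq_mul]
    ring
  rw [aux, aux, h φ h1 h2 h3, mul_neg]

theorem MemH2.add {u u' : BranchL2} (h : MemH2 u) (h' : MemH2 u') : MemH2 (u + u') := by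
  obtain ⟨g, k, h1, h2⟩ := h
  obtain ⟨g', k', h1', h2'⟩ := h'
  exact ⟨g + g', k + k', h1.add h1', h2.add h2'⟩

theorem MemH2.smul {u : BranchL2} (z : ℂ) (h : MemH2 u) : MemH2 (z • u) := by
  obtain ⟨g, k, h1, h2⟩ := h
  exact ⟨z • g, z • k, h1.smul z, h2.smul z⟩

theorem weakDeriv2_add {u u' : BranchL2} (h : MemH2 u) (h' : MemH2 u') :
    weakDeriv (weakDeriv (u + u')) = weakDeriv (weakDeriv u) + weakDeriv (weakDeriv u') := by
  obtain ⟨g, k, h1, h2⟩ := h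
  obtain ⟨g', k', h1', h2'⟩ := h'
  rw [(h1.add h1').weakDeriv_eq, (h2.add h2').weakDeriv_eq, h1.weakDeriv_eq, h2.weakDeriv_eq,
    h1'.weakDeriv_eq, h2'.weakDeriv_eq]

theorem weakDeriv2_smul {u : BranchL2} (z : ℂ) (h : MemH2 u) :
    weakDeriv (weakDeriv (z • u)) = z • weakDeriv (weakDeriv u) := by
  obtain ⟨g, k, h1, h2⟩ := h
  rw [(h1.smul z).weakDeriv_eq, (h2.smul z).weakDeriv_eq, h1.weakDeriv_eq, h2.weakDeriv_eq]

/-! ### Transmission conditions and the operator -/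

/-- The tuple of functions `v` represents the class `u ∈ H`, branch by branch. -/
def Represents {n : ℕ} (v : Fin n → ℝ → ℂ) (u : NetL2 n) : Prop :=
  ∀ k, u k =ᵐ[volume.restrict (Ioi (0 : ℝ))] v k

/-- Condition `(T₀)`: each `vₖ` is continuous on the closed branch `[0, ∞)`, and the values at the
vertex agree, so that `v` is a continuous function on the network. -/
def T0 {n : ℕ} (v : Fin n → ℝ → ℂ) : Prop :=
  (∀ k, ContinuousOn (v k) (Ici 0)) ∧ ∀ i k, v i 0 = v k 0

/-- Condition `(T₁)`: each `vₖ` is `C¹` on the closed branch `[0, ∞)`, and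
`∑ₖ cₖ ∂ₓvₖ(0⁺) = 0`. -/
def T1 {n : ℕ} (c : Fin n → ℝ) (v : Fin n → ℝ → ℂ) : Prop :=
  (∀ k, ContDiffOn ℝ 1 (v k) (Ici 0)) ∧ ∑ k, (c k : ℂ) * derivWithin (v k) (Ici 0) 0 = 0

/-- The domain `D(A)`: tuples in `∏ₖ H²(Nₖ)` whose (continuously differentiable) representative
satisfies `(T₀)` and `(T₁)`. -/
def domA {n : ℕ} (c : Fin n → ℝ) : Submodule ℂ (NetL2 n) where
  carrier := {u | (∀ k, MemH2 (u k)) ∧ ∃ v, Represents v u ∧ T0 v ∧ T1 c v}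
  zero_mem' := by
    refine ⟨fun k => ⟨0, 0, hasWeakDeriv_zero, hasWeakDeriv_zero⟩, fun _ _ => 0, ?_, ?_, ?_⟩
    · intro k
      exact Lp.coeFn_zero ℂ 2 _
    · exact ⟨fun _ => continuousOn_const, fun _ _ => rfl⟩
    · exact ⟨fun _ => contDiffOn_const, by simp⟩
  add_mem' := by
    rintro u u' ⟨h, v, r, t0, t1⟩ ⟨h', v', r', t0', t1'⟩
    refine ⟨fun k => (h k).add (h' k), fun k x => v k x + v' k x, ?_, ?_, ?_⟩
    · intro k
      filter_upwards [Lp.coeFn_add (u k) (u' k), r k, r' k] with x hx h1 h2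
      rw [PiLp.add_apply, hx, Pi.add_apply, h1, h2]
    · exact ⟨fun k => (t0.1 k).add (t0'.1 k), fun i k => by
        simp only [t0.2 i k, t0'.2 i k]⟩
    · refine ⟨fun k => (t1.1 k).add (t1'.1 k), ?_⟩
      have e : ∀ k, derivWithin (fun x => v k x + v' k x) (Ici 0) 0
          = derivWithin (v k) (Ici 0) 0 + derivWithin (v' k) (Ici 0) 0 := fun k =>
        derivWithin_fun_add ((t1.1 k).differentiableOn (by simp) 0 (by simp))
          ((t1'.1 k).differentiableOn (by simp) 0 (by simp))
      simp only [e, mul_add, Finset.sum_add_distrib, t1.2, t1'.2, add_zero]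
  smul_mem' := by
    rintro z u ⟨h, v, r, t0, t1⟩
    refine ⟨fun k => (h k).smul z, fun k x => z * v k x, ?_, ?_, ?_⟩
    · intro k
      filter_upwards [Lp.coeFn_smul z (u k), r k] with x hx h1
      rw [PiLp.smul_apply, hx, Pi.smul_apply, h1, smul_eq_mul]
    · exact ⟨fun k => continuousOn_const.mul (t0.1 k), fun i k => by
        simp only [t0.2 i k]⟩
    · refine ⟨fun k => contDiffOn_const.mul (t1.1 k), ?_⟩
      have e : ∀ k, derivWithin (fun x => z * v k x) (Ici 0) 0
          = z * derivWithin (v k) (Ici 0) 0 := fun k =>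
        derivWithin_const_mul z ((t1.1 k).differentiableOn (by simp) 0 (by simp))
      simp only [e, mul_left_comm, ← Finset.mul_sum, t1.2, mul_zero]

/-- The operator `A = (-cₖ ∂ₓ² + aₖ)ₖ` with domain `D(A)`. -/
def opA {n : ℕ} (c a : Fin n → ℝ) : NetL2 n →ₗ.[ℂ] NetL2 n where
  domain := domA c
  toFun :=
    { toFun := fun u => WithLp.toLp 2 fun k =>
        -((c k : ℂ) • weakDeriv (weakDeriv (u.1 k))) + (a k : ℂ) • u.1 k
      map_add' := by
        intro u u'
        refine PiLp.ext fun k => ?_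
        have e := weakDeriv2_add (u.2.1 k) (u'.2.1 k)
        simp only [Submodule.coe_add, PiLp.add_apply, e, smul_add]
        abel
      map_smul' := by
        intro z u
        refine PiLp.ext fun k => ?_
        have e := weakDeriv2_smul z (u.2.1 k)
        simp only [Submodule.coe_smul, PiLp.smul_apply, e, RingHom.id_apply, smul_add, smul_neg,
          smul_comm z] }

/-! ### Resolvents of unbounded operators -/

section Resolvent

variable {E : Type*} [NormedAddCommGroup E] [NormedSpace ℂ E]

/-- `R` is a bounded two-sided inverse of `z I - T : D(T) → E`. -/
def IsResolventAt (T : E →ₗ.[ℂ] E) (z : ℂ) (R : E →L[ℂ] E) : Prop :=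
  (∀ f, ∃ hf : R f ∈ T.domain, z • R f - T ⟨R f, hf⟩ = f) ∧
    ∀ u : T.domain, R (z • (u : E) - T u) = u

/-- The resolvent set `ρ(T)`. -/
def resolventSet (T : E →ₗ.[ℂ] E) : Set ℂ := {z | ∃ R, IsResolventAt T z R}

open Classical in
/-- The resolvent `R(z, T) = (z I - T)⁻¹`, for `z ∈ ρ(T)` (zero otherwise). -/
def resolvent (z : ℂ) (T : E →ₗ.[ℂ] E) : E →L[ℂ] E :=
  if h : ∃ R, IsResolventAt T z R then h.choose else 0

theorem IsResolventAt.unique {T : E →ₗ.[ℂ] E} {z : ℂ} {R R' : E →L[ℂ] E}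
    (h : IsResolventAt T z R) (h' : IsResolventAt T z R') : R = R' := by
  ext f
  obtain ⟨hf, e⟩ := h'.1 f
  have := h.2 ⟨R' f, hf⟩
  rw [e] at this
  exact this

theorem isResolventAt_resolvent {T : E →ₗ.[ℂ] E} {z : ℂ} (h : z ∈ resolventSet T) :
    IsResolventAt T z (resolvent z T) := by
  have h' : ∃ R, IsResolventAt T z R := h
  rw [resolvent, dif_pos h']
  exact h'.choose_spec

end Resolvent

/-! ### Generalized eigenfunctions and the kernel -/

/-- The argument of `z` taken in `[-π, π)`. -/
def argLow (z : ℂ) : ℝ := if z.arg = Real.pi then -Real.pi else z.arg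

/-- The square root `√(r e^{iφ}) = √r e^{iφ/2}` for `r > 0`, `φ ∈ [-π, π)`, with `√0 = 0`. -/
def csqrt (z : ℂ) : ℂ := (Real.sqrt ‖z‖ : ℂ) * Complex.exp (Complex.I * ((argLow z / 2 : ℝ) : ℂ))

/-- `ξₖ(λ) = √((λ - aₖ) / cₖ)`. -/
def xi {n : ℕ} (c a : Fin n → ℝ) (k : Fin n) (z : ℂ) : ℂ := csqrt ((z - a k) / c k)

/-- `sₖ(λ) = - (∑_{l ≠ k} c_l ξ_l(λ)) / (cₖ ξₖ(λ))`. -/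
def sCoef {n : ℕ} (c a : Fin n → ℝ) (k : Fin n) (z : ℂ) : ℂ :=
  -(∑ l ∈ Finset.univ.erase k, (c l : ℂ) * xi c a l z) / (c k * xi c a k z)

/-- The restriction `F_{λ,k}^{±,j}` to the branch `Nₖ` of the generalized eigenfunction
`F_λ^{±,j}`; the sign `±` is the parameter `σ = ±1`. -/
def genEig {n : ℕ} (c a : Fin n → ℝ) (σ z : ℂ) (j k : Fin n) (x : ℝ) : ℂ :=
  if k = j then
    Complex.cos (xi c a j z * x) + σ * Complex.I * sCoef c a j z * Complex.sin (xi c a j z * x)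
  else Complex.exp (σ * Complex.I * xi c a k z * x)

/-- The sign used in the kernel: `+` if `Im λ > 0`, and `-` if `Im λ ≤ 0`. -/
def kernelSign (z : ℂ) : ℂ := if 0 < z.im then 1 else -1

/-- The Wronskian `w(λ) = ± i ∑ⱼ cⱼ ξⱼ(λ)`. -/
def wronskian {n : ℕ} (c a : Fin n → ℝ) (z : ℂ) : ℂ :=
  kernelSign z * Complex.I * ∑ j, (c j : ℂ) * xi c a j z

/-- The index `j + 1` modulo `n`. -/
def cycSucc {n : ℕ} (j : Fin n) : Fin n :=
  ⟨(j.val + 1) % n, Nat.mod_lt _ (lt_of_le_of_lt (Nat.zero_le _) j.isLt)⟩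

/-- The kernel `K(x, x', λ)` for `x` in the closed branch `j` and `x'` in the closed branch `k`. -/
def kernel {n : ℕ} (c a : Fin n → ℝ) (z : ℂ) (j : Fin n) (x : ℝ) (k : Fin n) (x' : ℝ) : ℂ :=
  if k = j ∧ x < x' then
    1 / wronskian c a z * genEig c a (kernelSign z) z j j x
      * genEig c a (kernelSign z) z (cycSucc j) j x'
  else
    1 / wronskian c a z * genEig c a (kernelSign z) z (cycSucc j) j x
      * genEig c a (kernelSign z) z j k x'

end StarNetwork

end

noncomputable section

namespace StarNetwork

/-! ### Calculus on the half-axis -/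

/-! The resolvent is given, so the formula is verified, not constructed. Every real `λ ≥ a₁` is in
the spectrum: wave packets on the first branch, supported away from the vertex, are approximate
eigenfunctions (`im_ne_zero_of_mem_resolventSet`). Hence `Im λ ≠ 0`. With the sign of the kernel,
every exponent `κₖ = ±iξₖ` then has negative real part, and so has `w = ∑ cₖκₖ`; this gives the
nonvanishing and the integrability.

The function `R(λ,A)f` has a `C¹` representative `v` with `cₖ(vₖ'' + ξₖ²vₖ) = fₖ` almost everywhere.
Substituting this for `f` in the kernel integral and applying Green's formula
(`IsH2Rep.integral_mul`) leaves only boundary terms. Those at infinity vanish, since `v` and `v'`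
grow at most linearly while the exponentials decay. At `x` the terms in `v'` cancel and those in `v`
add up to `w v(x)` (`mul_wronskian_det_eq`). At the vertex everything cancels, because both `v` and
`F^{±,j}` are continuous there and satisfy Kirchhoff's condition (`mul_genEigDeriv_zero`). The sum
is assembled in `eq_sum_integral_kernel`. -/

theorem integral_mul_eq_of_primitive {ψ ψ' h p : ℝ → ℂ} {α β : ℝ} (hαβ : α ≤ β)
    (hψ : ∀ x, HasDerivAt ψ (ψ' x) x) (hψ' : Continuous ψ')
    (hh : IntegrableOn h (Ioc α β)) (hp : ∀ x ∈ Icc α β, p x = p α + ∫ t in α..x, h t) :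
    ∫ x in α..β, ψ x * h x = ψ β * p β - ψ α * p α - ∫ x in α..β, ψ' x * p x := by
  have hI : IntervalIntegrable h volume α β := (intervalIntegrable_iff_integrableOn_Ioc_of_le hαβ).2 hh
  have hψc : Continuous ψ := continuous_iff_continuousAt.2 fun x => (hψ x).continuousAt
  have hψ'I : ∀ a b, IntervalIntegrable ψ' volume a b := fun a b => hψ'.intervalIntegrable a b
  -- Since `p` is only the primitive of an integrable function, integration by parts is done by
  -- Fubini on the triangle `t ≤ x`.
  let K : ℝ → ℝ → ℂ := fun x t => if t ≤ x then ψ' x * h t else 0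
  have hint : Integrable (Function.uncurry K)
      ((volume.restrict (Ioc α β)).prod (volume.restrict (Ioc α β))) := by
    have h1 : Integrable ψ' (volume.restrict (Ioc α β)) :=
      (intervalIntegrable_iff_integrableOn_Ioc_of_le hαβ).1 (hψ'I α β)
    have h2 := (h1.mul_prod hh).indicator
      (measurableSet_le (measurable_snd (α := ℝ) (β := ℝ)) measurable_fst)
    refine h2.congr (Filter.Eventually.of_forall fun y => ?_)
    obtain ⟨x, t⟩ := y
    simp only [indicator, mem_ofPred_eq, Function.uncurry, K]
  have hswap := integral_integral_swap hint
  have e1 : ∀ x ∈ Ioc α β, ∫ t in Ioc α β, K x t = ψ' x * (p x - p α) := by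
    intro x hx
    rw [hp x ⟨hx.1.le, hx.2⟩, add_sub_cancel_left, intervalIntegral.integral_of_le hx.1.le,
      ← integral_const_mul]
    have : (fun t => K x t) = (Iic x).indicator fun t => ψ' x * h t := by
      funext t
      simp only [K, indicator, mem_Iic]
    rw [this, setIntegral_indicator measurableSet_Iic]
    congr 2
    ext t
    simp only [mem_inter_iff, mem_Ioc, mem_Iic]
    exact ⟨fun H => ⟨H.1.1, H.2⟩, fun H => ⟨⟨H.1, H.2.trans hx.2⟩, H.2⟩⟩
  have e2 : ∀ t ∈ Ioc α β, ∫ x in Ioc α β, K x t = (ψ β - ψ t) * h t := by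
    intro t ht
    have : (fun x => K x t) = (Ici t).indicator fun x => ψ' x * h t := by
      funext x
      simp only [K, indicator, mem_Ici]
    rw [this, setIntegral_indicator measurableSet_Ici,
      show Ioc α β ∩ Ici t = Icc t β by
        ext x
        simp only [mem_inter_iff, mem_Ioc, mem_Icc, mem_Ici]
        exact ⟨fun H => ⟨H.2, H.1.2⟩, fun H => ⟨⟨ht.1.trans_le H.1, H.2⟩, H.1⟩⟩,
      integral_mul_const, integral_Icc_eq_integral_Ioc, ← intervalIntegral.integral_of_le ht.2,
      intervalIntegral.integral_eq_sub_of_hasDerivAt (fun x _ => hψ x) (hψ'I t β)]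
  rw [setIntegral_congr_fun measurableSet_Ioc e1, setIntegral_congr_fun measurableSet_Ioc e2,
    ← intervalIntegral.integral_of_le hαβ, ← intervalIntegral.integral_of_le hαβ] at hswap
  have hpc : ContinuousOn p (uIcc α β) := by
    rw [uIcc_of_le hαβ]
    have hc := intervalIntegral.continuousOn_primitive_interval (μ := volume) (f := h) (a := α)
      (b := β) (by rwa [uIcc_of_le hαβ, integrableOn_Icc_iff_integrableOn_Ioc])
    rw [uIcc_of_le hαβ] at hc
    exact (continuousOn_const.add hc).congr hp
  have i1 : IntervalIntegrable (fun x => ψ' x * p x) volume α β :=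
    (hψ'.continuousOn.mul hpc).intervalIntegrable
  have i2 : IntervalIntegrable (fun x => ψ x * h x) volume α β :=
    hI.continuousOn_mul hψc.continuousOn
  simp only [mul_sub, sub_mul] at hswap
  rw [intervalIntegral.integral_sub i1 ((hψ'I α β).mul_const _),
    intervalIntegral.integral_sub (hI.const_mul _) i2, intervalIntegral.integral_mul_const,
    intervalIntegral.integral_const_mul,
    intervalIntegral.integral_eq_sub_of_hasDerivAt (fun x _ => hψ x) (hψ'I α β)] at hswap
  have hb := hp β ⟨hαβ, le_rfl⟩
  have : ∫ t in α..β, h t = p β - p α := by rw [hb]; ring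
  rw [this] at hswap
  linear_combination hswap

/-- The test functions on the open half-axis. -/
structure IsTest (φ : ℝ → ℝ) : Prop where
  smooth : ContDiff ℝ ∞ φ
  compact : HasCompactSupport φ
  supp : tsupport φ ⊆ Ioi 0

theorem isTest_of_support {φ : ℝ → ℝ} (h : ContDiff ℝ ∞ φ) {a b : ℝ} (ha : 0 < a)
    (hs : Function.support φ ⊆ Icc a b) : IsTest φ := by
  have : tsupport φ ⊆ Icc a b := closure_minimal hs isClosed_Icc
  exact ⟨h, isCompact_Icc.of_isClosed_subset (isClosed_tsupport φ) this,
    this.trans fun x hx => ha.trans_le hx.1⟩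

theorem IsTest.exists_support {φ : ℝ → ℝ} (h : IsTest φ) :
    ∃ a b, 0 < a ∧ a < b ∧ Function.support φ ⊆ Icc a b := by
  rcases (tsupport φ).eq_empty_or_nonempty with he | hne
  · exact ⟨1, 2, by norm_num, by norm_num, ((subset_tsupport φ).trans he.subset).trans
      (empty_subset _)⟩
  obtain ⟨a, ha, hmin⟩ := IsCompact.exists_isLeast h.compact hne
  obtain ⟨b, hb, hmax⟩ := IsCompact.exists_isGreatest h.compact hne
  refine ⟨a, b + 1, h.supp ha, by linarith [hmin hb], fun x hx => ?_⟩
  have := subset_tsupport φ hx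
  exact ⟨hmin this, by linarith [hmax this]⟩

theorem IsTest.deriv {φ : ℝ → ℝ} (h : IsTest φ) : IsTest (deriv φ) :=
  ⟨(contDiff_infty_iff_deriv.1 h.smooth).2, h.compact.deriv,
    tsupport_deriv_subset.trans h.supp⟩

theorem IsTest.sub_const_mul {φ η : ℝ → ℝ} (h : IsTest φ) (h' : IsTest η) (r : ℝ) :
    IsTest (fun x => φ x - r * η x) := by
  obtain ⟨a, b, ha, -, hs⟩ := h.exists_support
  obtain ⟨a', b', ha', -, hs'⟩ := h'.exists_support
  refine isTest_of_support (h.smooth.sub (contDiff_const.mul h'.smooth))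
    (lt_min ha ha') (b := max b b') fun x hx => ?_
  by_cases h1 : φ x = 0
  · have h2 : η x ≠ 0 := fun h2 => hx (by simp [h1, h2])
    exact ⟨(min_le_right _ _).trans (hs' h2).1, (hs' h2).2.trans (le_max_right _ _)⟩
  · exact ⟨(min_le_left _ _).trans (hs h1).1, (hs h1).2.trans (le_max_left _ _)⟩

/-! ### The du Bois-Reymond lemma on the half-axis -/

theorem exists_isTest_integral_eq_one : ∃ η, IsTest η ∧ ∫ x in Ioi (0 : ℝ), η x = 1 := by
  let b : ContDiffBump (2 : ℝ) := ⟨1 / 2, 1, by norm_num, by norm_num⟩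
  have hsup : Function.support (b.normed volume) ⊆ Icc 1 3 := by
    rw [b.support_normed_eq]
    intro x hx
    rw [Real.ball_eq_Ioo] at hx
    have : b.rOut = 1 := rfl
    rw [this] at hx
    constructor <;> linarith [hx.1, hx.2]
  refine ⟨b.normed volume, isTest_of_support b.contDiff_normed one_pos hsup, ?_⟩
  rw [setIntegral_eq_integral_of_forall_compl_eq_zero, b.integral_normed]
  intro x hx
  by_contra hne
  exact hx (show (0 : ℝ) < x by linarith [(hsup hne).1])

theorem IsTest.integral_Ioi_eq {φ : ℝ → ℝ} (h : IsTest φ) {a b : ℝ} (hab : a ≤ b)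
    (hs : Function.support φ ⊆ Icc a b) (q : ℝ → ℂ) :
    ∫ x in Ioi (0 : ℝ), (φ x : ℂ) * q x = ∫ x in a..b, (φ x : ℂ) * q x := by
  rw [intervalIntegral.integral_of_le hab, ← integral_Icc_eq_integral_Ioc]
  have hz : ∀ x, x ∉ Icc a b → (φ x : ℂ) * q x = 0 := by
    intro x hx
    have : φ x = 0 := by
      by_contra hne
      exact hx (hs hne)
    simp [this]
  rw [setIntegral_eq_integral_of_forall_compl_eq_zero hz,
    setIntegral_eq_integral_of_forall_compl_eq_zero]
  intro x hx
  have : φ x = 0 := by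
    by_contra hne
    exact hx (h.supp (subset_tsupport φ hne))
  simp [this]

/-- The primitive from `0` vanishes to the left of the support of `ψ` trivially, and to the right of
it because the mean is zero. -/
theorem IsTest.exists_primitive {ψ : ℝ → ℝ} (h : IsTest ψ) (h0 : ∫ x in Ioi (0 : ℝ), ψ x = 0) :
    ∃ φ, IsTest φ ∧ _root_.deriv φ = ψ := by
  obtain ⟨a, b, ha, hab, hs⟩ := h.exists_support
  have hd : ∀ x, HasDerivAt (fun x => ∫ t in (0 : ℝ)..x, ψ t) (ψ x) x := fun x =>
    intervalIntegral.integral_hasDerivAt_right (h.smooth.continuous.intervalIntegrable _ _)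
      h.smooth.continuous.stronglyMeasurable.stronglyMeasurableAtFilter
      h.smooth.continuous.continuousAt
  have hde : _root_.deriv (fun x => ∫ t in (0 : ℝ)..x, ψ t) = ψ := funext fun x => (hd x).deriv
  refine ⟨fun x => ∫ t in (0 : ℝ)..x, ψ t, isTest_of_support ?_ ha (b := b) ?_, hde⟩
  · rw [contDiff_infty_iff_deriv, hde]
    exact ⟨fun x => (hd x).differentiableAt, h.smooth⟩
  · intro x hx
    by_contra hxab
    apply hx
    have hz : ∀ t, t ∉ Icc a b → ψ t = 0 := fun t ht => by
      by_contra hne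
      exact ht (hs hne)
    rcases lt_or_ge x a with hxa | hxa
    · refine (intervalIntegral.integral_congr (g := fun _ => (0 : ℝ)) fun t ht => hz t fun H => ?_).trans
        (by simp)
      have : t ≤ max 0 x := ht.2
      linarith [H.1, max_lt ha hxa]
    · have hxb : b < x := by
        by_contra hh
        exact hxab ⟨hxa, not_lt.1 hh⟩
      show ∫ t in (0 : ℝ)..x, ψ t = 0
      rw [intervalIntegral.integral_of_le (by linarith)]
      refine Eq.trans ?_ h0
      refine (setIntegral_eq_of_subset_of_forall_sdiff_eq_zero measurableSet_Ioi
        Ioc_subset_Ioi_self fun t ht => hz t fun H => ht.2 ⟨ht.1, by linarith [H.2]⟩).symm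

theorem IsTest.integrableOn_mul {φ : ℝ → ℝ} (h : IsTest φ) {q : ℝ → ℂ}
    (hq : ContinuousOn q (Ici 0)) : IntegrableOn (fun x => (φ x : ℂ) * q x) (Ioi 0) := by
  obtain ⟨a, b, ha, hab, hs⟩ := h.exists_support
  have : IntegrableOn (fun x => (φ x : ℂ) * q x) (Icc a b) := by
    refine ContinuousOn.integrableOn_Icc ?_
    exact (Complex.continuous_ofReal.comp h.smooth.continuous).continuousOn.mul
      (hq.mono fun x hx => ha.le.trans hx.1)
  refine this.of_forall_sdiff_eq_zero measurableSet_Ioi fun x hx => ?_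
  have : φ x = 0 := by
    by_contra hne
    exact hx.2 (hs hne)
  simp [this]

/-- For a fixed `η` of integral one, `φ - (∫ φ) η` has mean zero, so it is the derivative of a test
function. Testing with that function shows `∫ φ (r - κ) = 0` for every `φ`, where `κ = ∫ η r`. -/
theorem eq_const_of_forall_integral_deriv_eq_zero {r : ℝ → ℂ} (hr : ContinuousOn r (Ici 0))
    (h : ∀ φ, IsTest φ → ∫ x in Ioi (0 : ℝ), ((deriv φ x : ℝ) : ℂ) * r x = 0) :
    ∀ x, 0 ≤ x → r x = r 0 := by
  obtain ⟨η, hη, hη1⟩ := exists_isTest_integral_eq_one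
  set κ : ℂ := ∫ x in Ioi (0 : ℝ), (η x : ℂ) * r x with hκ
  have hae := IsOpen.ae_eq_zero_of_integral_contDiff_smul_eq_zero (isOpen_Ioi (a := (0 : ℝ)))
    (f := fun x => r x - κ)
    ((hr.sub continuousOn_const).mono Ioi_subset_Ici_self |>.locallyIntegrableOn measurableSet_Ioi)
    (by
      intro φ h1 h2 h3
      have hφ : IsTest φ := ⟨h1, h2, h3⟩
      have hiφ : IntegrableOn φ (Ioi 0) :=
        (h1.continuous.integrable_of_hasCompactSupport h2).integrableOn
      have hiφc : IntegrableOn (fun x => (φ x : ℂ)) (Ioi 0) := hiφ.ofReal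
      have hiη : IntegrableOn η (Ioi 0) :=
        (hη.smooth.continuous.integrable_of_hasCompactSupport hη.compact).integrableOn
      set m : ℝ := ∫ x in Ioi (0 : ℝ), φ x with hm
      obtain ⟨θ, hθ, hθd⟩ := (hφ.sub_const_mul hη m).exists_primitive (by
        rw [integral_sub hiφ (hiη.const_mul m), integral_const_mul, hη1, mul_one, sub_self])
      have e := h θ hθ
      rw [hθd] at e
      have e' : ∫ x in Ioi (0 : ℝ), (φ x : ℂ) * r x = m * κ := by
        rw [hκ, ← integral_const_mul, ← sub_eq_zero, ← integral_sub (hφ.integrableOn_mul hr)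
          ((hη.integrableOn_mul hr).const_mul _), ← e]
        congr 1
        funext x
        push_cast
        ring
      rw [← setIntegral_eq_integral_of_forall_compl_eq_zero (s := Ioi 0) (μ := volume)]
      · simp only [Complex.real_smul, mul_sub]
        rw [integral_sub (hφ.integrableOn_mul hr) (hiφc.mul_const κ), e',
          integral_mul_const, integral_complex_ofReal, ← hm, sub_self]
      · intro x hx
        have : φ x = 0 := by
          by_contra hne
          exact hx (h3 (subset_tsupport φ hne))
        simp [this])
  have hpos : EqOn r (fun _ => κ) (Ioi 0) := by
    have : r =ᵐ[volume.restrict (Ioi 0)] fun _ => κ := by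
      rw [Filter.EventuallyEq, ae_restrict_iff' measurableSet_Ioi]
      filter_upwards [hae] with x hx hx0
      exact sub_eq_zero.1 (hx hx0)
    exact Measure.eqOn_open_of_ae_eq this isOpen_Ioi (hr.mono Ioi_subset_Ici_self)
      continuousOn_const
  have hall : EqOn r (fun _ => κ) (Ici 0) := by
    refine hpos.of_subset_closure hr continuousOn_const Ioi_subset_Ici_self ?_
    rw [closure_Ioi]
  intro x hx
  rw [hall hx, hall (show (0 : ℝ) ∈ Ici 0 from mem_Ici.2 le_rfl)]

/-- A continuous function whose weak derivative is locally integrable is its primitive. -/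
theorem eq_add_integral_of_weak_deriv {q g : ℝ → ℂ} (hq : ContinuousOn q (Ici 0))
    (hg : ∀ b, IntegrableOn g (Ioc 0 b))
    (h : ∀ φ, IsTest φ → ∫ x in Ioi (0 : ℝ), ((deriv φ x : ℝ) : ℂ) * q x
      = - ∫ x in Ioi (0 : ℝ), ((φ x : ℝ) : ℂ) * g x) :
    ∀ x, 0 ≤ x → q x = q 0 + ∫ t in (0 : ℝ)..x, g t := by
  have hGc : ContinuousOn (fun x => ∫ t in (0 : ℝ)..x, g t) (Ici 0) := by
    intro x hx
    have hc := intervalIntegral.continuousOn_primitive_interval (μ := volume) (f := g) (a := 0)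
      (b := x + 1) (by
        rw [uIcc_of_le (by linarith [show (0 : ℝ) ≤ x from hx]),
          integrableOn_Icc_iff_integrableOn_Ioc]
        exact hg _)
    rw [uIcc_of_le (by linarith [show (0 : ℝ) ≤ x from hx])] at hc
    refine (hc x ⟨hx, by linarith⟩).mono_of_mem_nhdsWithin ?_
    rw [← Ici_inter_Iic]
    exact inter_mem_nhdsWithin _ (Iic_mem_nhds (by linarith))
  have key := eq_const_of_forall_integral_deriv_eq_zero (hq.sub hGc) (by
    intro φ hφ
    obtain ⟨a, b, ha, hab, hs⟩ := hφ.exists_support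
    have hb0 : 0 ≤ b := by linarith
    -- Both `0` and `b + 1` lie outside `[a, b]`, so `φ` vanishes at the two ends and the boundary
    -- terms drop out.
    have hs' : Function.support φ ⊆ Icc 0 (b + 1) := hs.trans (Icc_subset_Icc ha.le (by linarith))
    have hsd : Function.support (deriv φ) ⊆ Icc 0 (b + 1) :=
      (support_deriv_subset.trans (closure_minimal hs isClosed_Icc)).trans
        (Icc_subset_Icc ha.le (by linarith))
    have e := integral_mul_eq_of_primitive (α := 0) (β := b + 1) (ψ := fun x => (φ x : ℂ))
      (ψ' := fun x => ((deriv φ x : ℝ) : ℂ)) (h := g) (p := fun x => ∫ t in (0 : ℝ)..x, g t)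
      (by linarith) (fun x => ((hφ.smooth.differentiable (by simp) x).hasDerivAt).ofReal_comp)
      (Complex.continuous_ofReal.comp hφ.deriv.smooth.continuous) (hg _) (by simp)
    have z1 : φ (b + 1) = 0 := by
      by_contra hne
      linarith [(hs hne).2]
    have z0 : φ 0 = 0 := by
      by_contra hne
      linarith [(hs hne).1]
    simp only [z1, z0, Complex.ofReal_zero, zero_mul, sub_zero, zero_sub] at e
    simp only [Pi.sub_apply, mul_sub]
    rw [integral_sub (hφ.deriv.integrableOn_mul hq) (hφ.deriv.integrableOn_mul hGc), h φ hφ,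
      hφ.integral_Ioi_eq (by linarith) hs', e,
      hφ.deriv.integral_Ioi_eq (by linarith) hsd]
    ring)
  intro x hx
  have := key x hx
  simp only [Pi.sub_apply, intervalIntegral.integral_same, sub_zero] at this
  rw [← this]
  ring

/-! ### Regularity, growth and Green's formula for `H²` functions -/

theorem integrableOn_Ioc_branch (g : BranchL2) {a b : ℝ} (ha : 0 ≤ a) :
    IntegrableOn g (Ioc a b) := by
  have h1 : MemLp g 2 (volume.restrict (Ioc a b)) :=
    (Lp.memLp g).mono_measure (Measure.restrict_mono (fun x hx => ha.trans_lt hx.1) le_rfl)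
  exact h1.integrable (by norm_num)

/-- This follows from `‖g‖ ≤ ‖g‖² + 1`. The linear bound is not sharp, but it suffices against
exponential decay. -/
theorem exists_norm_integral_le_add (g : BranchL2) :
    ∃ C, ∀ x, 0 ≤ x → ‖∫ t in (0 : ℝ)..x, g t‖ ≤ C + x := by
  have hsq : IntegrableOn (fun t => ‖g t‖ ^ 2) (Ioi 0) :=
    (memLp_two_iff_integrable_sq_norm (Lp.memLp g).1).1 (Lp.memLp g)
  refine ⟨∫ t in Ioi (0 : ℝ), ‖g t‖ ^ 2, fun x hx => ?_⟩
  have hsub : Ioc 0 x ⊆ Ioi 0 := Ioc_subset_Ioi_self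
  have hc : IntegrableOn (fun _ : ℝ => (1 : ℝ)) (Ioc 0 x) := by simp
  rw [intervalIntegral.integral_of_le hx]
  calc ‖∫ t in Ioc 0 x, g t‖ ≤ ∫ t in Ioc 0 x, ‖g t‖ := norm_integral_le_integral_norm _
    _ ≤ ∫ t in Ioc 0 x, (‖g t‖ ^ 2 + 1) := by
      refine integral_mono (integrableOn_Ioc_branch g le_rfl).norm
        ((hsq.mono_set hsub).add hc) fun t => ?_
      nlinarith [sq_nonneg (‖g t‖ - 1)]
    _ = (∫ t in Ioc 0 x, ‖g t‖ ^ 2) + x := by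
      rw [integral_add (hsq.mono_set hsub) hc]
      simp [hx]
    _ ≤ _ := by
      refine add_le_add_left ?_ x
      exact setIntegral_mono_set hsq (Filter.Eventually.of_forall fun t => by positivity)
        hsub.eventuallyLE

theorem HasWeakDeriv.eq_add_integral {u g : BranchL2} (h : HasWeakDeriv u g) {v : ℝ → ℂ}
    (hv : ContinuousOn v (Ici 0)) (huv : u =ᵐ[volume.restrict (Ioi (0 : ℝ))] v) :
    ∀ x, 0 ≤ x → v x = v 0 + ∫ t in (0 : ℝ)..x, g t := by
  refine eq_add_integral_of_weak_deriv hv (fun b => integrableOn_Ioc_branch g le_rfl) fun φ hφ => ?_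
  rw [← h φ hφ.smooth hφ.compact hφ.supp]
  refine integral_congr_ae ?_
  filter_upwards [huv] with x hx
  rw [hx]

/-- Lebesgue differentiation of `v = v 0 + ∫ g`, with `g` extended by zero to the line. It makes the
classical derivative of `v` a continuous representative of `g`, so that the primitive formula can be
applied once more. -/
theorem HasWeakDeriv.ae_eq_derivWithin {u g : BranchL2} (h : HasWeakDeriv u g) {v : ℝ → ℂ}
    (hv : ContDiffOn ℝ 1 v (Ici 0)) (huv : u =ᵐ[volume.restrict (Ioi (0 : ℝ))] v) :
    g =ᵐ[volume.restrict (Ioi (0 : ℝ))] derivWithin v (Ici 0) := by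
  have heq := h.eq_add_integral hv.continuousOn huv
  let G : ℝ → ℂ := (Ioi (0 : ℝ)).indicator g
  have hG : LocallyIntegrable G := by
    have : MemLp G 2 volume := (memLp_indicator_iff_restrict measurableSet_Ioi).2 (Lp.memLp g)
    exact this.locallyIntegrable (by norm_num)
  have hae := _root_.LocallyIntegrable.ae_hasDerivAt_integral hG
  rw [Filter.EventuallyEq, ae_restrict_iff' measurableSet_Ioi]
  filter_upwards [hae] with x hx hx0
  have hd := (hx 0).const_add (v 0)
  have hev : v =ᶠ[nhds x] fun y => v 0 + ∫ t in (0 : ℝ)..y, G t := by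
    filter_upwards [Ioi_mem_nhds hx0] with y hy
    rw [heq y (le_of_lt hy), intervalIntegral.integral_of_le (le_of_lt hy),
      intervalIntegral.integral_of_le (le_of_lt hy)]
    congr 1
    refine setIntegral_congr_fun measurableSet_Ioc fun t ht => ?_
    simp only [G, indicator_of_mem (show t ∈ Ioi (0 : ℝ) from ht.1)]
  have hd' := hd.congr_of_eventuallyEq hev
  rw [(hd'.hasDerivWithinAt (s := Ici 0)).derivWithin (uniqueDiffOn_Ici 0 x (mem_Ici.2 (le_of_lt hx0)))]
  simp only [G, indicator_of_mem hx0]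

/-- The `C¹` representative `v` of an `H²` function, its derivative `p` and its second weak
derivative `h`. -/
structure IsH2Rep (v p h : ℝ → ℂ) : Prop where
  hasDeriv : ∀ x, 0 < x → HasDerivAt v (p x) x
  cont : ContinuousOn v (Ici 0)
  int : ∀ a b, 0 ≤ a → IntegrableOn h (Ioc a b)
  eq : ∀ x, 0 ≤ x → p x = p 0 + ∫ t in (0 : ℝ)..x, h t
  growth : ∃ C, ∀ x, 0 ≤ x → ‖v x‖ ≤ C + x
  growth' : ∃ C, ∀ x, 0 ≤ x → ‖p x‖ ≤ C + x

theorem isH2Rep_of_hasWeakDeriv {u g h : BranchL2} (h1 : HasWeakDeriv u g)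
    (h2 : HasWeakDeriv g h) {v : ℝ → ℂ} (hv : ContDiffOn ℝ 1 v (Ici 0))
    (huv : u =ᵐ[volume.restrict (Ioi (0 : ℝ))] v) :
    IsH2Rep v (derivWithin v (Ici 0)) h := by
  have hae := h1.ae_eq_derivWithin hv huv
  have hpc : ContinuousOn (derivWithin v (Ici 0)) (Ici 0) :=
    hv.continuousOn_derivWithin (uniqueDiffOn_Ici 0) le_rfl
  have e1 := h1.eq_add_integral hv.continuousOn huv
  have e2 := h2.eq_add_integral hpc hae
  have bound : ∀ {q : ℝ → ℂ} {k : BranchL2}, (∀ x, 0 ≤ x → q x = q 0 + ∫ t in (0 : ℝ)..x, k t) →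
      ∃ C, ∀ x, 0 ≤ x → ‖q x‖ ≤ C + x := by
    intro q k hq
    obtain ⟨C, hC⟩ := exists_norm_integral_le_add k
    refine ⟨‖q 0‖ + C, fun x hx => ?_⟩
    rw [hq x hx, add_assoc]
    exact (norm_add_le _ _).trans (by gcongr; exact hC x hx)
  refine ⟨fun x hx => ?_, hv.continuousOn, fun a b ha => integrableOn_Ioc_branch h ha, e2,
    bound e1, bound e2⟩
  exact ((hv.differentiableOn (by simp) x hx.le).hasDerivWithinAt).hasDerivAt (Ici_mem_nhds hx)

/-- Green's formula for `F'' + sF = 0` against `r (v'' + s v) = f`. Two integrations by parts are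
combined: `F` against `p' = h`, where `p` is only a primitive, and `F'` against `v' = p`, which is
classical. -/
theorem IsH2Rep.integral_mul {v p h f F F' : ℝ → ℂ} (H : IsH2Rep v p h) {r : ℝ} {s : ℂ}
    (hf : f =ᵐ[volume.restrict (Ioi (0 : ℝ))] fun x => r * (h x + s * v x))
    (hF : ∀ x, HasDerivAt F (F' x) x) (hF' : ∀ x, HasDerivAt F' (-s * F x) x)
    {α β : ℝ} (hα : 0 ≤ α) (hαβ : α ≤ β) :
    ∫ x in α..β, F x * f x
      = r * ((F β * p β - F' β * v β) - (F α * p α - F' α * v α)) := by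
  have hFc : Continuous F := continuous_iff_continuousAt.2 fun x => (hF x).continuousAt
  have hF'c : Continuous F' := continuous_iff_continuousAt.2 fun x => (hF' x).continuousAt
  have hii : ∀ a b, 0 ≤ a → a ≤ b → IntervalIntegrable h volume a b := fun a b ha hab =>
    (intervalIntegrable_iff_integrableOn_Ioc_of_le hab).2 (H.int a b ha)
  have hp : ∀ x ∈ Icc α β, p x = p α + ∫ t in α..x, h t := by
    intro x hx
    rw [H.eq x (hα.trans hx.1), H.eq α hα, add_assoc, intervalIntegral.integral_add_adjacent_intervals
      (hii _ _ le_rfl hα) (hii _ _ hα hx.1)]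
  have hpc : ContinuousOn p (uIcc α β) := by
    rw [uIcc_of_le hαβ]
    have hc := intervalIntegral.continuousOn_primitive_interval (μ := volume) (f := h) (a := α)
      (b := β) (by rw [uIcc_of_le hαβ, integrableOn_Icc_iff_integrableOn_Ioc]; exact H.int _ _ hα)
    rw [uIcc_of_le hαβ] at hc
    exact (continuousOn_const.add hc).congr hp
  have hvc : ContinuousOn v (uIcc α β) := by
    rw [uIcc_of_le hαβ]
    exact H.cont.mono fun x hx => hα.trans hx.1
  have e1 := integral_mul_eq_of_primitive hαβ hF hF'c (H.int α β hα) hp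
  have e2 := intervalIntegral.integral_mul_deriv_eq_deriv_mul_of_hasDerivAt (u := F') (v := v)
    (u' := fun x => -s * F x) (v' := p) hF'c.continuousOn hvc (fun x _ => hF' x)
    (fun x hx => H.hasDeriv x (by rw [min_eq_left hαβ] at hx; exact hα.trans_lt hx.1))
    ((continuous_const.mul hFc).intervalIntegrable _ _) hpc.intervalIntegrable
  have i1 : IntervalIntegrable (fun x => F x * h x) volume α β :=
    (hii α β hα hαβ).continuousOn_mul hFc.continuousOn
  have i2 : IntervalIntegrable (fun x => F x * v x) volume α β :=
    (hFc.continuousOn.mul hvc).intervalIntegrable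
  have e3 : ∫ x in α..β, F x * f x = ∫ x in α..β, (r * (F x * h x) + r * s * (F x * v x)) := by
    rw [intervalIntegral.integral_of_le hαβ, intervalIntegral.integral_of_le hαβ]
    refine integral_congr_ae ?_
    filter_upwards [ae_restrict_of_ae_restrict_of_subset
      (show Ioc α β ⊆ Ioi 0 from fun x hx => hα.trans_lt hx.1) hf] with x hx
    rw [hx]
    ring
  rw [e3, intervalIntegral.integral_add (i1.const_mul _) (i2.const_mul _),
    intervalIntegral.integral_const_mul, intervalIntegral.integral_const_mul]
  have e4 : ∫ x in α..β, -s * F x * v x = -s * ∫ x in α..β, F x * v x := by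
    rw [← intervalIntegral.integral_const_mul]
    congr 1
    funext x
    ring
  rw [e4] at e2
  rw [e1, e2]
  ring

/-! ### Decaying exponentials on the half-axis -/

theorem hasDerivAt_cexp_mul (κ : ℂ) (x : ℝ) :
    HasDerivAt (fun y : ℝ => Complex.exp (κ * y)) (κ * Complex.exp (κ * x)) x := by
  have h := ((Complex.ofRealCLM.hasDerivAt (x := x)).const_mul κ).cexp
  simp only [Complex.ofRealCLM_apply, Complex.ofReal_one, mul_one] at h
  rw [mul_comm]
  exact h

theorem memLp_cexp_mul {κ : ℂ} (hκ : κ.re < 0) (a : ℝ) :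
    MemLp (fun x : ℝ => Complex.exp (κ * x)) 2 (volume.restrict (Ioi a)) := by
  have hc : Continuous fun x : ℝ => Complex.exp (κ * x) := by fun_prop
  rw [memLp_two_iff_integrable_sq_norm hc.aestronglyMeasurable]
  have : (fun x : ℝ => ‖Complex.exp (κ * x)‖ ^ 2) = fun x : ℝ => Real.exp ((2 * κ.re) * x) := by
    funext x
    rw [Complex.norm_exp, ← Real.exp_nat_mul]
    simp
    ring_nf
  rw [this]
  exact integrableOn_exp_mul_Ioi (by linarith) a

theorem integrableOn_cexp_mul_branch {κ : ℂ} (hκ : κ.re < 0) (f : BranchL2) :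
    IntegrableOn (fun x : ℝ => Complex.exp (κ * x) * f x) (Ioi 0) :=
  (memLp_cexp_mul hκ 0).integrable_mul (Lp.memLp f)

theorem tendsto_cexp_mul_mul {κ : ℂ} (hκ : κ.re < 0) {q : ℝ → ℂ}
    (hq : ∃ C, ∀ x, 0 ≤ x → ‖q x‖ ≤ C + x) :
    Filter.Tendsto (fun x : ℝ => Complex.exp (κ * x) * q x) Filter.atTop (nhds 0) := by
  obtain ⟨C, hC⟩ := hq
  have h0 : Filter.Tendsto (fun x : ℝ => Real.exp (κ.re * x)) Filter.atTop (nhds 0) :=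
    Real.tendsto_exp_atBot.comp (Filter.tendsto_id.const_mul_atTop_of_neg hκ)
  have h1 : Filter.Tendsto (fun x : ℝ => x * Real.exp (κ.re * x)) Filter.atTop (nhds 0) := by
    have := tendsto_rpow_mul_exp_neg_mul_atTop_nhds_zero 1 (-κ.re) (by linarith)
    simpa using this
  have h2 : Filter.Tendsto (fun x : ℝ => C * Real.exp (κ.re * x) + x * Real.exp (κ.re * x))
      Filter.atTop (nhds 0) := by
    simpa using (h0.const_mul C).add h1
  refine squeeze_zero_norm' ?_ h2
  filter_upwards [Filter.eventually_ge_atTop 0] with x hx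
  rw [norm_mul, Complex.norm_exp]
  have : (κ * x).re = κ.re * x := by simp
  rw [this, ← add_mul, mul_comm]
  gcongr
  exact hC x hx

/-- Green's formula on `[α, β]` as `β → ∞`: the boundary term at `β` is an exponential times
functions of linear growth. -/
theorem IsH2Rep.integral_Ioi_cexp_mul {v p h : ℝ → ℂ} {f : BranchL2} (H : IsH2Rep v p h) {r : ℝ}
    {s κ : ℂ} (hf : f =ᵐ[volume.restrict (Ioi (0 : ℝ))] fun x => r * (h x + s * v x))
    (hκ : κ.re < 0) (hs : κ ^ 2 = -s) {α : ℝ} (hα : 0 ≤ α) :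
    ∫ x in Ioi α, Complex.exp (κ * x) * f x
      = -(r * (Complex.exp (κ * α) * p α - κ * Complex.exp (κ * α) * v α)) := by
  have hi : IntegrableOn (fun x : ℝ => Complex.exp (κ * x) * f x) (Ioi α) :=
    (integrableOn_cexp_mul_branch hκ f).mono_set (Ioi_subset_Ioi hα)
  have lim := intervalIntegral_tendsto_integral_Ioi α hi Filter.tendsto_id
  have lim2 : Filter.Tendsto (fun β : ℝ => r * ((Complex.exp (κ * β) * p β
      - κ * (Complex.exp (κ * β) * v β)) - (Complex.exp (κ * α) * p α
      - κ * Complex.exp (κ * α) * v α))) Filter.atTop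
      (nhds (r * ((0 - κ * 0) - (Complex.exp (κ * α) * p α
      - κ * Complex.exp (κ * α) * v α)))) :=
    (((tendsto_cexp_mul_mul hκ H.growth').sub
      ((tendsto_cexp_mul_mul hκ H.growth).const_mul κ)).sub_const _).const_mul _
  have heq := tendsto_nhds_unique_of_eventuallyEq lim lim2 (by
    filter_upwards [Filter.eventually_ge_atTop α] with β hβ
    rw [id, H.integral_mul hf (hasDerivAt_cexp_mul κ) (fun x => by
      have := (hasDerivAt_cexp_mul κ x).const_mul κ
      rwa [← mul_assoc, ← sq, hs] at this) hα hβ]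
    ring)
  rw [heq]
  ring

/-! ### The square root -/

theorem csqrt_sq (z : ℂ) : csqrt z ^ 2 = z := by
  have h1 : ((Real.sqrt ‖z‖ : ℝ) : ℂ) ^ 2 = (‖z‖ : ℂ) := by
    rw [← Complex.ofReal_pow, Real.sq_sqrt (norm_nonneg z)]
  have h2 : Complex.exp (Complex.I * ((argLow z / 2 : ℝ) : ℂ)) ^ 2
      = Complex.exp (z.arg * Complex.I) := by
    rw [← Complex.exp_nat_mul]
    unfold argLow
    split_ifs with h
    · rw [h, Complex.exp_eq_exp_iff_exists_int]
      -- On the negative axis the argument used is `-π` instead of `π`; after squaring, the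
      -- difference is a full period.
      refine ⟨-1, ?_⟩
      push_cast
      ring
    · congr 1
      push_cast
      ring
  rw [csqrt, mul_pow, h1, h2, Complex.norm_mul_exp_arg_mul_I]

theorem csqrt_im (z : ℂ) : (csqrt z).im = Real.sqrt ‖z‖ * Real.sin (argLow z / 2) := by
  rw [csqrt, mul_comm Complex.I, Complex.im_ofReal_mul, Complex.exp_ofReal_mul_I_im]

/-- Off the real axis, halving the argument keeps the sign of the imaginary part. As `w.im` is a
positive multiple of `z.im`, the one sign determined by `z` serves all branches. -/
theorem kernelSign_mul_csqrt_im_pos {z w : ℂ} (hz : z.im ≠ 0) {r : ℝ} (hr : 0 < r)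
    (hw : w.im = r * z.im) : 0 < (kernelSign z * csqrt w).im := by
  have hwim : w.im ≠ 0 := hw ▸ mul_ne_zero hr.ne' hz
  have hw0 : w ≠ 0 := fun h => hwim (by simp [h])
  have hnorm : 0 < Real.sqrt ‖w‖ := Real.sqrt_pos.2 (norm_pos_iff.2 hw0)
  have hlow : argLow w = w.arg := if_neg fun h => hwim (Complex.arg_eq_pi_iff.1 h).2
  have hb := Complex.arg_mem_Ioc w
  have hne : w.arg ≠ 0 := fun h => hwim (Complex.arg_eq_zero_iff.1 h).2
  unfold kernelSign
  split_ifs with h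
  · have : 0 ≤ w.arg := Complex.arg_nonneg_iff.2 (hw ▸ (mul_pos hr h).le)
    have hpos : 0 < w.arg := lt_of_le_of_ne this hne.symm
    rw [one_mul, csqrt_im, hlow]
    exact mul_pos hnorm (Real.sin_pos_of_pos_of_lt_pi (by linarith) (by linarith [hb.2]))
  · have : z.im < 0 := lt_of_le_of_ne (not_lt.1 h) hz
    have hneg : w.arg < 0 := Complex.arg_neg_iff.2 (hw ▸ mul_neg_of_pos_of_neg hr this)
    rw [neg_one_mul, Complex.neg_im, csqrt_im, hlow, ← mul_neg, ← Real.sin_neg]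
    exact mul_pos hnorm (Real.sin_pos_of_pos_of_lt_pi (by linarith) (by linarith [hb.1]))

/-! ### Points of the spectrum on the real axis -/

/-- The modulated and dilated test function `ψ(ε x) e^{iμx}`. -/
def wave (ψ : ℝ → ℝ) (ε μ x : ℝ) : ℂ := (ψ (ε * x) : ℂ) * Complex.exp (Complex.I * μ * x)

theorem norm_wave (ψ : ℝ → ℝ) (ε μ x : ℝ) : ‖wave ψ ε μ x‖ = |ψ (ε * x)| := by
  rw [wave, norm_mul, Complex.norm_real, Complex.norm_exp]
  simp

theorem IsTest.hasDerivAt_wave {ψ : ℝ → ℝ} (h : IsTest ψ) (ε μ x : ℝ) :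
    HasDerivAt (wave ψ ε μ)
      (ε * wave (_root_.deriv ψ) ε μ x + Complex.I * μ * wave ψ ε μ x) x := by
  have h1 : HasDerivAt (fun y : ℝ => ψ (ε * y)) (_root_.deriv ψ (ε * x) * ε) x := by
    have := (h.smooth.differentiable (by simp) (ε * x)).hasDerivAt.comp x
      ((hasDerivAt_id x).const_mul ε)
    exact this.congr_deriv (by simp)
  refine (h1.ofReal_comp.mul (hasDerivAt_cexp_mul (Complex.I * μ) x)).congr_deriv ?_
  simp only [wave]
  push_cast
  ring

theorem IsTest.contDiff_wave {ψ : ℝ → ℝ} (h : IsTest ψ) (ε μ : ℝ) : ContDiff ℝ ∞ (wave ψ ε μ) := by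
  have h1 : ContDiff ℝ ∞ fun x : ℝ => ψ (ε * x) := h.smooth.comp (contDiff_const.mul contDiff_id)
  have h2 : ContDiff ℝ ∞ fun x : ℝ => (ψ (ε * x) : ℂ) := Complex.ofRealCLM.contDiff.comp h1
  have h3 : ContDiff ℝ ∞ fun x : ℝ => Complex.exp (Complex.I * μ * x) :=
    (contDiff_const.mul Complex.ofRealCLM.contDiff).cexp
  exact h2.mul h3

theorem IsTest.memLp_wave {ψ : ℝ → ℝ} (h : IsTest ψ) {ε : ℝ} (hε : 0 < ε) (μ : ℝ) :
    MemLp (wave ψ ε μ) 2 (volume.restrict (Ioi (0 : ℝ))) := by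
  refine ((h.contDiff_wave ε μ).continuous.memLp_of_hasCompactSupport ?_).restrict _
  have : HasCompactSupport fun x : ℝ => (ψ (ε * x) : ℂ) :=
    (h.compact.comp_homeomorph (Homeomorph.mulLeft₀ ε hε.ne')).comp_left
      (g := fun r : ℝ => (r : ℂ)) (by simp)
  exact this.mul_right

/-- The class of `wave ψ ε μ` in `L²`. -/
def IsTest.waveL2 {ψ : ℝ → ℝ} (h : IsTest ψ) {ε : ℝ} (hε : 0 < ε) (μ : ℝ) : BranchL2 :=
  (h.memLp_wave hε μ).toLp

/-- The point is that the factor `√ε⁻¹` does not depend on `ψ`, so it cancels when the waves of `ψ`,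
`ψ'` and `ψ''` are compared. -/
theorem IsTest.norm_waveL2 {ψ : ℝ → ℝ} (h : IsTest ψ) {ε : ℝ} (hε : 0 < ε) (μ : ℝ) :
    ‖h.waveL2 hε μ‖ = Real.sqrt ε⁻¹ * Real.sqrt (∫ x in Ioi (0 : ℝ), ψ x ^ 2) := by
  have h1 : ((‖h.waveL2 hε μ‖ ^ 2 : ℝ) : ℂ) = ((ε⁻¹ * ∫ x in Ioi (0 : ℝ), ψ x ^ 2 : ℝ) : ℂ) := by
    have e := @inner_self_eq_norm_sq_to_K ℂ _ _ _ _ (h.waveL2 hε μ)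
    have e2 : ∫ x in Ioi (0 : ℝ), ψ (ε * x) ^ 2 = ε⁻¹ * ∫ x in Ioi (0 : ℝ), ψ x ^ 2 := by
      rw [integral_comp_mul_left_Ioi (fun x => ψ x ^ 2) 0 hε, mul_zero, smul_eq_mul]
    rw [← e2, ← integral_complex_ofReal, Complex.ofReal_pow]
    refine e.symm.trans ?_
    rw [L2.inner_def]
    refine integral_congr_ae ?_
    filter_upwards [(h.memLp_wave hε μ).coeFn_toLp] with x hx
    have hx' : h.waveL2 hε μ x = wave ψ ε μ x := hx
    rw [hx', inner_self_eq_norm_sq_to_K, norm_wave]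
    show ((|ψ (ε * x)| : ℝ) : ℂ) ^ 2 = _
    rw [← Complex.ofReal_pow, sq_abs]
  rw [← Real.sqrt_mul (inv_nonneg.2 hε.le), ← Complex.ofReal_injective h1,
    Real.sqrt_sq (norm_nonneg _)]

theorem hasWeakDeriv_of_hasDerivAt {u g : BranchL2} {θ θ' : ℝ → ℂ}
    (hθ : ∀ x, HasDerivAt θ (θ' x) x) (hθ' : Continuous θ')
    (hu : u =ᵐ[volume.restrict (Ioi (0 : ℝ))] θ) (hg : g =ᵐ[volume.restrict (Ioi (0 : ℝ))] θ') :
    HasWeakDeriv u g := by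
  intro φ h1 h2 h3
  have hφ : IsTest φ := ⟨h1, h2, h3⟩
  obtain ⟨a, b, ha, hab, hs⟩ := hφ.exists_support
  have hs' : Function.support φ ⊆ Icc 0 (b + 1) := hs.trans (Icc_subset_Icc ha.le (by linarith))
  have hsd : Function.support (deriv φ) ⊆ Icc 0 (b + 1) :=
    (support_deriv_subset.trans (closure_minimal hs isClosed_Icc)).trans
      (Icc_subset_Icc ha.le (by linarith))
  have z1 : φ (b + 1) = 0 := by
    by_contra hne
    linarith [(hs hne).2]
  have z0 : φ 0 = 0 := by
    by_contra hne
    linarith [(hs hne).1]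
  have e := intervalIntegral.integral_mul_deriv_eq_deriv_mul (a := 0) (b := b + 1)
    (u := fun x => (φ x : ℂ)) (u' := fun x => ((deriv φ x : ℝ) : ℂ)) (v := θ) (v' := θ')
    (fun x _ => ((h1.differentiable (by simp) x).hasDerivAt).ofReal_comp) (fun x _ => hθ x)
    ((Complex.continuous_ofReal.comp hφ.deriv.smooth.continuous).intervalIntegrable _ _)
    (hθ'.intervalIntegrable _ _)
  simp only [z1, z0, Complex.ofReal_zero, zero_mul, sub_zero, zero_sub] at e
  have e1 : ∫ x in Ioi (0 : ℝ), ((deriv φ x : ℝ) : ℂ) * u x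
      = ∫ x in Ioi (0 : ℝ), ((deriv φ x : ℝ) : ℂ) * θ x :=
    integral_congr_ae (by filter_upwards [hu] with x hx; rw [hx])
  have e2 : ∫ x in Ioi (0 : ℝ), (φ x : ℂ) * g x = ∫ x in Ioi (0 : ℝ), (φ x : ℂ) * θ' x :=
    integral_congr_ae (by filter_upwards [hg] with x hx; rw [hx])
  rw [e1, e2, hφ.integral_Ioi_eq (by linarith) hs', hφ.deriv.integral_Ioi_eq (by linarith) hsd, e,
    neg_neg]

theorem IsTest.hasWeakDeriv_waveL2 {ψ : ℝ → ℝ} (h : IsTest ψ) {ε : ℝ} (hε : 0 < ε) (μ : ℝ) :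
    HasWeakDeriv (h.waveL2 hε μ)
      ((ε : ℂ) • h.deriv.waveL2 hε μ + (Complex.I * μ) • h.waveL2 hε μ) := by
  refine hasWeakDeriv_of_hasDerivAt (h.hasDerivAt_wave ε μ) ?_ (h.memLp_wave hε μ).coeFn_toLp ?_
  · exact (continuous_const.mul (h.deriv.contDiff_wave ε μ).continuous).add
      (continuous_const.mul (h.contDiff_wave ε μ).continuous)
  · filter_upwards [Lp.coeFn_add ((ε : ℂ) • h.deriv.waveL2 hε μ) ((Complex.I * μ) • h.waveL2 hε μ),
      Lp.coeFn_smul (ε : ℂ) (h.deriv.waveL2 hε μ), Lp.coeFn_smul (Complex.I * μ) (h.waveL2 hε μ),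
      (h.memLp_wave hε μ).coeFn_toLp, (h.deriv.memLp_wave hε μ).coeFn_toLp] with x h1 h2 h3 h4 h5
    rw [h1, Pi.add_apply, h2, h3, Pi.smul_apply, Pi.smul_apply, smul_eq_mul, smul_eq_mul]
    unfold IsTest.waveL2
    rw [h4, h5]

theorem IsTest.apply_zero {ψ : ℝ → ℝ} (h : IsTest ψ) : ψ 0 = 0 := by
  by_contra hne
  exact lt_irrefl (0 : ℝ) (h.supp (subset_tsupport ψ hne))

/-- The support stays away from the vertex, so both transmission conditions read `0 = 0`. -/
theorem IsTest.single_waveL2_mem_domA {n : ℕ} (c : Fin n → ℝ) (i : Fin n) {ψ : ℝ → ℝ}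
    (h : IsTest ψ) {ε : ℝ} (hε : 0 < ε) (μ : ℝ) :
    (PiLp.single 2 i (h.waveL2 hε μ) : NetL2 n) ∈ domA c := by
  have hw := h.hasWeakDeriv_waveL2 hε μ
  have hw2 := ((h.deriv.hasWeakDeriv_waveL2 hε μ).smul (ε : ℂ)).add (hw.smul (Complex.I * μ))
  have w0 : wave ψ ε μ 0 = 0 := by simp [wave, h.apply_zero]
  have d0 : HasDerivAt (wave ψ ε μ) 0 0 := by
    refine (h.hasDerivAt_wave ε μ 0).congr_deriv ?_
    simp [wave, h.apply_zero, h.deriv.apply_zero]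
  refine ⟨fun k => ?_, fun k x => if k = i then wave ψ ε μ x else 0, fun k => ?_, ⟨fun k => ?_,
    fun j k => ?_⟩, fun k => ?_, Finset.sum_eq_zero fun k _ => ?_⟩
  · by_cases hk : k = i
    · subst hk
      rw [PiLp.single_eq_same]
      exact ⟨_, _, hw, hw2⟩
    · rw [PiLp.single_eq_of_ne _ hk]
      exact ⟨0, 0, hasWeakDeriv_zero, hasWeakDeriv_zero⟩
  · by_cases hk : k = i
    · subst hk
      simp only [PiLp.single_eq_same, if_true]
      exact (h.memLp_wave hε μ).coeFn_toLp
    · simp only [PiLp.single_eq_of_ne _ hk, if_neg hk]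
      exact Lp.coeFn_zero ℂ 2 _
  · by_cases hk : k = i
    · simp only [hk, if_true]
      exact (h.contDiff_wave ε μ).continuous.continuousOn
    · simp only [if_neg hk]
      exact continuousOn_const
  · simp only [w0, ite_self]
  · by_cases hk : k = i
    · simp only [hk, if_true]
      exact ((h.contDiff_wave ε μ).of_le (by exact_mod_cast le_top)).contDiffOn
    · simp only [if_neg hk]
      exact contDiffOn_const
  · by_cases hk : k = i
    · simp only [hk, if_true]
      rw [(d0.hasDerivWithinAt (s := Ici 0)).derivWithin (uniqueDiffOn_Ici 0 0 (mem_Ici.2 le_rfl)),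
        mul_zero]
    · simp [if_neg hk]

/-- The frequency `μ` is tuned so that the term without derivatives of `ψ` cancels; what is left
carries a factor `ε`. -/
theorem IsTest.sub_opA_single_waveL2 {n : ℕ} (c a : Fin n → ℝ) (i : Fin n) {ψ : ℝ → ℝ}
    (h : IsTest ψ) {ε : ℝ} (hε : 0 < ε) {μ : ℝ} {z : ℂ} (hz : z - a i = c i * (μ : ℂ) ^ 2) :
    z • (PiLp.single 2 i (h.waveL2 hε μ) : NetL2 n)
        - opA c a ⟨_, h.single_waveL2_mem_domA c i hε μ⟩
      = PiLp.single 2 i ((c i * (ε : ℂ) ^ 2) • h.deriv.deriv.waveL2 hε μ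
          + (c i * (2 * ε * Complex.I * μ)) • h.deriv.waveL2 hε μ) := by
  have hw := h.hasWeakDeriv_waveL2 hε μ
  have hw2 := ((h.deriv.hasWeakDeriv_waveL2 hε μ).smul (ε : ℂ)).add (hw.smul (Complex.I * μ))
  refine PiLp.ext fun k => ?_
  show z • (PiLp.single 2 i (h.waveL2 hε μ) : NetL2 n) k
    - (-((c k : ℂ) • weakDeriv (weakDeriv ((PiLp.single 2 i (h.waveL2 hε μ) : NetL2 n) k)))
      + (a k : ℂ) • (PiLp.single 2 i (h.waveL2 hε μ) : NetL2 n) k) = _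
  by_cases hk : k = i
  · subst hk
    simp only [PiLp.single_eq_same]
    rw [hw.weakDeriv_eq, hw2.weakDeriv_eq]
    have hz' : z = a k + c k * (μ : ℂ) ^ 2 := by linear_combination hz
    rw [hz']
    have hI : Complex.I ^ 2 = -1 := Complex.I_sq
    match_scalars
    · linear_combination (c k : ℂ) * (μ : ℂ) ^ 2 * hI
    · ring
    · ring
  · simp only [PiLp.single_eq_of_ne _ hk]
    rw [hasWeakDeriv_zero.weakDeriv_eq, hasWeakDeriv_zero.weakDeriv_eq]
    simp

theorem IsTest.integral_sq_pos {ψ : ℝ → ℝ} (h : IsTest ψ) (h0 : ∫ x in Ioi (0 : ℝ), ψ x ≠ 0) :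
    0 < ∫ x in Ioi (0 : ℝ), ψ x ^ 2 := by
  have hs : HasCompactSupport fun x => ψ x ^ 2 := by
    simp only [sq]
    exact h.compact.mul_left (f := ψ)
  have hcont : Continuous fun x => ψ x ^ 2 := h.smooth.continuous.pow 2
  have hi : IntegrableOn (fun x => ψ x ^ 2) (Ioi 0) :=
    (hcont.integrable_of_hasCompactSupport hs).integrableOn
  refine lt_of_le_of_ne (integral_nonneg fun x => sq_nonneg _) fun he => h0 ?_
  have h1 := (integral_eq_zero_iff_of_nonneg (fun x => sq_nonneg (ψ x)) hi).1 he.symm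
  refine integral_eq_zero_of_ae ?_
  filter_upwards [h1] with x hx
  exact pow_eq_zero_iff two_ne_zero |>.1 hx

/-- The half-axis `[aᵢ, ∞)` lies in the spectrum. -/
theorem im_ne_zero_of_mem_resolventSet {n : ℕ} {c a : Fin n → ℝ} {i : Fin n} (hc : 0 < c i)
    {z : ℂ} (hz : z ∈ resolventSet (opA c a)) (hre : a i ≤ z.re) : z.im ≠ 0 := by
  intro him
  obtain ⟨R, -, hR⟩ := hz
  obtain ⟨ψ, hψ, hψ1⟩ := exists_isTest_integral_eq_one
  set μ : ℝ := Real.sqrt ((z.re - a i) / c i) with hμ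
  have hμz : z - a i = c i * (μ : ℂ) ^ 2 := by
    rw [← Complex.ofReal_pow, hμ, Real.sq_sqrt (div_nonneg (by linarith) hc.le),
      ← Complex.ofReal_mul, mul_div_cancel₀ _ hc.ne']
    apply Complex.ext <;> simp [him]
  let A : (ℝ → ℝ) → ℝ := fun φ => Real.sqrt (∫ x in Ioi (0 : ℝ), φ x ^ 2)
  have hA : 0 < A ψ := Real.sqrt_pos.2 (hψ.integral_sq_pos (hψ1 ▸ one_ne_zero))
  -- `R` recovers the wave from its image under `z - A`. After division by the common factor `√ε⁻¹`
  -- the right side tends to `0` with `ε`, which contradicts `0 < A ψ`.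
  have key : ∀ ε : ℝ, 0 < ε → A ψ ≤ ‖R‖ * (c i * ε ^ 2 * A (deriv (deriv ψ))
      + c i * (2 * ε * μ) * A (deriv ψ)) := by
    intro ε hε
    have e := hR ⟨_, hψ.single_waveL2_mem_domA c i hε μ⟩
    simp only at e
    rw [hψ.sub_opA_single_waveL2 c a i hε hμz] at e
    have hle := R.le_opNorm (PiLp.single 2 i ((c i * (ε : ℂ) ^ 2) • hψ.deriv.deriv.waveL2 hε μ
          + (c i * (2 * ε * Complex.I * μ)) • hψ.deriv.waveL2 hε μ))
    rw [e, PiLp.norm_single, PiLp.norm_single] at hle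
    have hn : ‖(c i * (ε : ℂ) ^ 2) • hψ.deriv.deriv.waveL2 hε μ
          + (c i * (2 * ε * Complex.I * μ)) • hψ.deriv.waveL2 hε μ‖
        ≤ c i * ε ^ 2 * ‖hψ.deriv.deriv.waveL2 hε μ‖
          + c i * (2 * ε * μ) * ‖hψ.deriv.waveL2 hε μ‖ := by
      refine (norm_add_le _ _).trans (le_of_eq ?_)
      rw [norm_smul, norm_smul]
      simp [abs_of_pos hc, abs_of_pos hε, abs_of_nonneg (show 0 ≤ μ from Real.sqrt_nonneg _)]
    have hle2 := hle.trans (mul_le_mul_of_nonneg_left hn (norm_nonneg R))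
    rw [hψ.norm_waveL2, hψ.deriv.norm_waveL2, hψ.deriv.deriv.norm_waveL2] at hle2
    have hs : 0 < Real.sqrt ε⁻¹ := Real.sqrt_pos.2 (inv_pos.2 hε)
    refine le_of_mul_le_mul_left (hle2.trans (le_of_eq ?_)) hs
    ring
  have hlim : Filter.Tendsto (fun ε : ℝ => ‖R‖ * (c i * ε ^ 2 * A (deriv (deriv ψ))
      + c i * (2 * ε * μ) * A (deriv ψ))) (nhdsWithin 0 (Ioi 0)) (nhds 0) := by
    have : Continuous (fun ε : ℝ => ‖R‖ * (c i * ε ^ 2 * A (deriv (deriv ψ))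
      + c i * (2 * ε * μ) * A (deriv ψ))) := by fun_prop
    have h0 := this.tendsto 0
    simp only [ne_eq, OfNat.ofNat_ne_zero, not_false_eq_true, zero_pow, mul_zero, zero_mul,
      add_zero] at h0
    exact h0.mono_left nhdsWithin_le_nhds
  have := ge_of_tendsto hlim (Filter.eventually_of_mem self_mem_nhdsWithin fun ε hε => key ε hε)
  linarith

/-! ### The kernel -/

/-- The exponent `±iξₖ(λ)` of the solution that decays on the branch `k`. -/
def decayExp {n : ℕ} (c a : Fin n → ℝ) (z : ℂ) (k : Fin n) : ℂ :=
  kernelSign z * Complex.I * xi c a k z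

theorem kernelSign_sq (z : ℂ) : kernelSign z ^ 2 = 1 := by
  unfold kernelSign
  split_ifs <;> norm_num

section

variable {n : ℕ} {c a : Fin n → ℝ} {z : ℂ}

theorem decayExp_re_neg (hc : ∀ k, 0 < c k) (hz : z.im ≠ 0) (k : Fin n) :
    (decayExp c a z k).re < 0 := by
  have h := kernelSign_mul_csqrt_im_pos (z := z) (w := (z - a k) / c k) hz (inv_pos.2 (hc k)) (by
    rw [Complex.div_ofReal_im, Complex.sub_im, Complex.ofReal_im, sub_zero, div_eq_inv_mul])
  have e : decayExp c a z k = Complex.I * (kernelSign z * csqrt ((z - a k) / c k)) := by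
    rw [decayExp, xi]
    ring
  rw [e, Complex.I_mul_re]
  linarith

theorem xi_sq (k : Fin n) : xi c a k z ^ 2 = (z - a k) / c k := csqrt_sq _

theorem decayExp_sq (k : Fin n) : decayExp c a z k ^ 2 = -xi c a k z ^ 2 := by
  rw [decayExp, mul_pow, mul_pow, kernelSign_sq, Complex.I_sq]
  ring

theorem xi_ne_zero (hc : ∀ k, 0 < c k) (hz : z.im ≠ 0) (k : Fin n) : xi c a k z ≠ 0 := by
  intro h
  have := decayExp_re_neg (a := a) hc hz k
  simp [decayExp, h] at this

theorem wronskian_eq_sum : wronskian c a z = ∑ k, (c k : ℂ) * decayExp c a z k := by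
  rw [wronskian, Finset.mul_sum]
  refine Finset.sum_congr rfl fun k _ => ?_
  rw [decayExp]
  ring

/-- As a combination of the decay exponents with positive weights, it has negative real part. -/
theorem wronskian_ne_zero (hn : 0 < n) (hc : ∀ k, 0 < c k) (hz : z.im ≠ 0) :
    wronskian c a z ≠ 0 := by
  intro h
  have : Nonempty (Fin n) := ⟨⟨0, hn⟩⟩
  have hre : (wronskian c a z).re < 0 := by
    rw [wronskian_eq_sum, Complex.re_sum]
    refine Finset.sum_neg (fun k _ => ?_) Finset.univ_nonempty
    rw [Complex.re_ofReal_mul]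
    exact mul_neg_of_pos_of_neg (hc k) (decayExp_re_neg hc hz k)
  simp [h] at hre

/-- Ensures that `F^{±,j+1}` restricted to the branch `j` is the decaying exponential. -/
theorem cycSucc_ne (hn : 2 ≤ n) (j : Fin n) : j ≠ cycSucc j := by
  intro h
  have hv : j.val = (j.val + 1) % n := congrArg Fin.val h
  have hj := j.isLt
  rcases lt_or_ge (j.val + 1) n with h1 | h1
  · rw [Nat.mod_eq_of_lt h1] at hv
    omega
  · have h2 : j.val + 1 = n := by omega
    rw [h2, Nat.mod_self] at hv
    omega

theorem genEig_of_ne {j k : Fin n} (h : k ≠ j) (x : ℝ) :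
    genEig c a (kernelSign z) z j k x = Complex.exp (decayExp c a z k * x) :=
  if_neg h

theorem kernel_of_ne (hn : 2 ≤ n) {j k : Fin n} (h : k ≠ j) (x x' : ℝ) :
    kernel c a z j x k x' = 1 / wronskian c a z * Complex.exp (decayExp c a z j * x)
      * Complex.exp (decayExp c a z k * x') := by
  rw [kernel, if_neg fun H => h H.1, genEig_of_ne (cycSucc_ne hn j), genEig_of_ne h]

theorem kernel_self_of_lt (hn : 2 ≤ n) {j : Fin n} {x x' : ℝ} (h : x < x') :
    kernel c a z j x j x' = 1 / wronskian c a z * genEig c a (kernelSign z) z j j x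
      * Complex.exp (decayExp c a z j * x') := by
  rw [kernel, if_pos ⟨rfl, h⟩, genEig_of_ne (cycSucc_ne hn j)]

theorem kernel_self_of_le (hn : 2 ≤ n) {j : Fin n} {x x' : ℝ} (h : x' ≤ x) :
    kernel c a z j x j x' = 1 / wronskian c a z * Complex.exp (decayExp c a z j * x)
      * genEig c a (kernelSign z) z j j x' := by
  rw [kernel, if_neg fun H => absurd H.2 (not_lt.2 h), genEig_of_ne (cycSucc_ne hn j)]

/-- The derivative of the eigenfunction `F^{±,j}` on its own branch. -/
def genEigDeriv (c a : Fin n → ℝ) (σ z : ℂ) (j : Fin n) (x : ℝ) : ℂ :=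
  xi c a j z * (-Complex.sin (xi c a j z * x)
    + σ * Complex.I * sCoef c a j z * Complex.cos (xi c a j z * x))

theorem hasDerivAt_genEig_self (σ : ℂ) (j : Fin n) (x : ℝ) :
    HasDerivAt (genEig c a σ z j j) (genEigDeriv c a σ z j x) x := by
  have h0 : HasDerivAt (fun y : ℝ => xi c a j z * (y : ℂ)) (xi c a j z) x := by
    simpa using (Complex.ofRealCLM.hasDerivAt (x := x)).const_mul (xi c a j z)
  have e : genEig c a σ z j j = fun y : ℝ => Complex.cos (xi c a j z * y)
      + σ * Complex.I * sCoef c a j z * Complex.sin (xi c a j z * y) :=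
    funext fun y => if_pos rfl
  rw [e]
  refine (((Complex.hasDerivAt_cos _).comp x h0).add
    (((Complex.hasDerivAt_sin _).comp x h0).const_mul (σ * Complex.I * sCoef c a j z))).congr_deriv ?_
  rw [genEigDeriv]
  ring

theorem hasDerivAt_genEigDeriv (σ : ℂ) (j : Fin n) (x : ℝ) :
    HasDerivAt (genEigDeriv c a σ z j) (-xi c a j z ^ 2 * genEig c a σ z j j x) x := by
  have h0 : HasDerivAt (fun y : ℝ => xi c a j z * (y : ℂ)) (xi c a j z) x := by
    simpa using (Complex.ofRealCLM.hasDerivAt (x := x)).const_mul (xi c a j z)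
  refine ((((Complex.hasDerivAt_sin _).comp x h0).neg.add (((Complex.hasDerivAt_cos _).comp x
    h0).const_mul (σ * Complex.I * sCoef c a j z))).const_mul (xi c a j z)).congr_deriv ?_
  rw [genEig, if_pos rfl]
  ring

theorem continuous_genEig_self (σ : ℂ) (j : Fin n) : Continuous (genEig c a σ z j j) :=
  continuous_iff_continuousAt.2 fun x => (hasDerivAt_genEig_self σ j x).continuousAt

theorem integrableOn_kernel_self_Ioi (hn : 2 ≤ n) (hc : ∀ k, 0 < c k) (hz : z.im ≠ 0) (j : Fin n)
    {x : ℝ} (hx : 0 ≤ x) (f : BranchL2) :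
    IntegrableOn (fun x' => kernel c a z j x j x' * f x') (Ioi x) := by
  refine IntegrableOn.congr_fun (f := fun x' : ℝ => 1 / wronskian c a z
      * genEig c a (kernelSign z) z j j x * (Complex.exp (decayExp c a z j * x') * f x'))
    (((integrableOn_cexp_mul_branch (decayExp_re_neg hc hz j) f).mono_set
      (Ioi_subset_Ioi hx)).const_mul _) (fun x' hx' => ?_) measurableSet_Ioi
  simp only [kernel_self_of_lt hn hx', mul_assoc]

theorem integrableOn_genEig_mul (j : Fin n) (x : ℝ) (f : BranchL2) :
    IntegrableOn (fun x' => genEig c a (kernelSign z) z j j x' * f x') (Ioc 0 x) := by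
  have h := (integrableOn_Ioc_branch f (b := x) le_rfl)
  rw [← integrableOn_Icc_iff_integrableOn_Ioc] at h ⊢
  exact h.continuousOn_mul (continuous_genEig_self _ j).continuousOn isCompact_Icc

theorem integrableOn_kernel_self_Ioc (hn : 2 ≤ n) (j : Fin n) (x : ℝ) (f : BranchL2) :
    IntegrableOn (fun x' => kernel c a z j x j x' * f x') (Ioc 0 x) := by
  refine IntegrableOn.congr_fun (f := fun x' : ℝ => 1 / wronskian c a z
      * Complex.exp (decayExp c a z j * x) * (genEig c a (kernelSign z) z j j x' * f x'))
    ((integrableOn_genEig_mul j x f).const_mul _) (fun x' hx' => ?_) measurableSet_Ioc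
  simp only [kernel_self_of_le hn hx'.2, mul_assoc]

/-- The possibly growing factor `F^{±,j}` on its own branch enters as a function of `x'` only on the
bounded interval `(0, x]`; elsewhere a decaying exponential meets an `L²` function. -/
theorem integrableOn_kernel (hn : 2 ≤ n) (hc : ∀ k, 0 < c k) (hz : z.im ≠ 0) (j : Fin n)
    {x : ℝ} (hx : 0 ≤ x) (k : Fin n) (f : BranchL2) :
    IntegrableOn (fun x' => kernel c a z j x k x' * f x') (Ioi 0) := by
  by_cases hk : k = j
  · subst hk
    have hun := (integrableOn_kernel_self_Ioc (c := c) (a := a) (z := z) hn k x f).union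
      (integrableOn_kernel_self_Ioi hn hc hz k hx f)
    rwa [Ioc_union_Ioi_eq_Ioi hx] at hun
  · simp only [kernel_of_ne hn hk, mul_assoc]
    exact ((integrableOn_cexp_mul_branch (decayExp_re_neg hc hz k) f).const_mul _).const_mul _

/-! ### Wronskian and vertex identities -/

theorem mul_xi_mul_sCoef {j : Fin n} (hc : c j ≠ 0) (hξ : xi c a j z ≠ 0) :
    (c j : ℂ) * xi c a j z * sCoef c a j z
      = -∑ k ∈ Finset.univ.erase j, (c k : ℂ) * xi c a k z := by
  have hc' : (c j : ℂ) ≠ 0 := Complex.ofReal_ne_zero.2 hc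
  rw [sCoef, mul_div_cancel₀ _ (mul_ne_zero hc' hξ)]

/-- The Wronskian identity on the branch `j`. -/
theorem mul_wronskian_det_eq {j : Fin n} (hc : c j ≠ 0) (hξ : xi c a j z ≠ 0) (x : ℝ) :
    (c j : ℂ) * Complex.exp (decayExp c a z j * x)
      * (decayExp c a z j * genEig c a (kernelSign z) z j j x
        - genEigDeriv c a (kernelSign z) z j x) = wronskian c a z := by
  have hs := mul_xi_mul_sCoef (z := z) (a := a) hc hξ
  have hsum := Finset.add_sum_erase Finset.univ (fun k => (c k : ℂ) * xi c a k z)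
    (Finset.mem_univ j)
  have hI : Complex.I ^ 2 = -1 := Complex.I_sq
  have hcs := Complex.sin_sq_add_cos_sq (xi c a j z * x)
  have hE : Complex.exp (decayExp c a z j * x)
      = Complex.cos (xi c a j z * x) + kernelSign z * Complex.I * Complex.sin (xi c a j z * x) := by
    rw [decayExp, kernelSign]
    split_ifs
    · rw [show 1 * Complex.I * xi c a j z * x = (xi c a j z * x) * Complex.I by ring,
        Complex.exp_mul_I]
      ring
    · rw [show -1 * Complex.I * xi c a j z * x = (-(xi c a j z * x)) * Complex.I by ring,
        Complex.exp_mul_I, Complex.cos_neg, Complex.sin_neg]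
      ring
  have hσ := kernelSign_sq z
  rw [hE, genEig, if_pos rfl, genEigDeriv, decayExp, wronskian, ← hsum]
  generalize Complex.cos (xi c a j z * x) = C at *
  generalize Complex.sin (xi c a j z * x) = S at *
  generalize ∑ k ∈ Finset.univ.erase j, (c k : ℂ) * xi c a k z = T at *
  generalize kernelSign z = σ at *
  generalize xi c a j z = ξ at *
  generalize sCoef c a j z = s at *
  generalize (c j : ℂ) = r at *
  -- Only `J² = -1` is used below, so both signs are treated at once.
  have hJ : (σ * Complex.I) ^ 2 = -1 := by rw [mul_pow, hσ, hI, one_mul]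
  generalize σ * Complex.I = J at *
  have e : r * (C + J * S) * (J * ξ * (C + J * s * S) - ξ * (-S + J * s * C))
      = J * (r * ξ - r * ξ * s) * (S ^ 2 + C ^ 2) := by
    linear_combination r * ξ * S * (C + J * S * s) * hJ
  -- The choice of `sⱼ` turns `cⱼξⱼ - cⱼξⱼsⱼ` into the full sum `∑ cₖξₖ`.
  rw [e, hcs, hs]
  ring

/-- Kirchhoff's condition for `F^{±,j}` at the vertex, which is what the coefficient `sⱼ` is made
for. -/
theorem mul_genEigDeriv_zero {j : Fin n} (hc : c j ≠ 0) (hξ : xi c a j z ≠ 0) :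
    (c j : ℂ) * genEigDeriv c a (kernelSign z) z j 0
      = -∑ k ∈ Finset.univ.erase j, (c k : ℂ) * decayExp c a z k := by
  have hs := mul_xi_mul_sCoef (z := z) (a := a) hc hξ
  have hsum : ∑ k ∈ Finset.univ.erase j, (c k : ℂ) * decayExp c a z k
      = kernelSign z * Complex.I * ∑ k ∈ Finset.univ.erase j, (c k : ℂ) * xi c a k z := by
    rw [Finset.mul_sum]
    refine Finset.sum_congr rfl fun k _ => ?_
    rw [decayExp]
    ring
  rw [genEigDeriv, hsum]
  simp only [Complex.ofReal_zero, mul_zero, Complex.sin_zero, Complex.cos_zero]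
  linear_combination kernelSign z * Complex.I * hs

theorem genEig_self_zero (σ : ℂ) (j : Fin n) : genEig c a σ z j j 0 = 1 := by
  simp [genEig]

/-- The representative of the resolvent, with the equation it solves on each branch. -/
theorem exists_rep_resolvent (hc : ∀ k, 0 < c k) (hz : z ∈ resolventSet (opA c a)) (f : NetL2 n) :
    ∃ v, Represents v (resolvent z (opA c a) f) ∧ T0 v ∧ T1 c v ∧
      ∀ k, ∃ h, IsH2Rep (v k) (derivWithin (v k) (Ici 0)) h ∧
        f k =ᵐ[volume.restrict (Ioi (0 : ℝ))] fun x => c k * (h x + xi c a k z ^ 2 * v k x) := by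
  obtain ⟨hu, hf⟩ := (isResolventAt_resolvent hz).1 f
  obtain ⟨hH2, v, hv, t0, t1⟩ := id hu
  refine ⟨v, hv, t0, t1, fun k => ?_⟩
  obtain ⟨g, h, h1, h2⟩ := hH2 k
  refine ⟨h, isH2Rep_of_hasWeakDeriv h1 h2 (t1.1 k) (hv k), ?_⟩
  set u := resolvent z (opA c a) f
  have hfk : f k = (c k : ℂ) • h + (z - a k) • u k := by
    have e : f k = z • u k - (-((c k : ℂ) • weakDeriv (weakDeriv (u k))) + (a k : ℂ) • u k) :=
      (congrArg (fun F : NetL2 n => F k) hf).symm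
    rw [e, h1.weakDeriv_eq, h2.weakDeriv_eq]
    module
  rw [hfk]
  filter_upwards [Lp.coeFn_add ((c k : ℂ) • h) ((z - a k) • u k), Lp.coeFn_smul (c k : ℂ) h,
    Lp.coeFn_smul (z - a k) (u k), hv k] with x e1 e2 e3 e4
  have hc' : (c k : ℂ) ≠ 0 := Complex.ofReal_ne_zero.2 (hc k).ne'
  rw [e1, Pi.add_apply, e2, e3, Pi.smul_apply, Pi.smul_apply, e4, xi_sq, smul_eq_mul, smul_eq_mul]
  field_simp

/-- A solution of the resolvent equation on the network that satisfies the transmission conditions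
is given by the kernel. -/
theorem eq_sum_integral_kernel (hn : 2 ≤ n) (hc : ∀ k, 0 < c k) (hz : z.im ≠ 0) {f : NetL2 n}
    {v : Fin n → ℝ → ℂ} (t0 : T0 v) (t1 : T1 c v)
    (H : ∀ k, ∃ h, IsH2Rep (v k) (derivWithin (v k) (Ici 0)) h ∧
      f k =ᵐ[volume.restrict (Ioi (0 : ℝ))] fun x => c k * (h x + xi c a k z ^ 2 * v k x))
    (j : Fin n) {x : ℝ} (hx : 0 ≤ x) :
    v j x = ∑ k, ∫ x' in Ioi (0 : ℝ), kernel c a z j x k x' * f k x' := by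
  have hw : wronskian c a z ≠ 0 := wronskian_ne_zero (by omega) hc hz
  have hξ := xi_ne_zero (a := a) hc hz j
  have hκ := fun k => decayExp_re_neg (a := a) hc hz k
  set E := Complex.exp (decayExp c a z j * x) with hE
  -- The other branches contribute only vertex terms, where continuity replaces `v k 0` by `v j 0`.
  have hother : ∀ k ∈ Finset.univ.erase j, ∫ x' in Ioi (0 : ℝ), kernel c a z j x k x' * f k x'
      = 1 / wronskian c a z * E * (-((c k : ℂ) * derivWithin (v k) (Ici 0) 0)
        + v j 0 * (c k * decayExp c a z k)) := by
    intro k hk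
    have hkj := Finset.ne_of_mem_erase hk
    obtain ⟨h, hrep, hf⟩ := H k
    simp only [kernel_of_ne hn hkj, mul_assoc]
    rw [integral_const_mul, integral_const_mul,
      hrep.integral_Ioi_cexp_mul hf (hκ k) (decayExp_sq k) le_rfl, t0.2 j k]
    simp only [Complex.ofReal_zero, mul_zero, Complex.exp_zero]
    ring
  obtain ⟨h, hrep, hf⟩ := H j
  have hself : ∫ x' in Ioi (0 : ℝ), kernel c a z j x j x' * f j x'
      = 1 / wronskian c a z * E * (∫ x' in (0 : ℝ)..x,
          genEig c a (kernelSign z) z j j x' * f j x')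
        + 1 / wronskian c a z * genEig c a (kernelSign z) z j j x
          * ∫ x' in Ioi x, Complex.exp (decayExp c a z j * x') * f j x' := by
    have hun := setIntegral_union (Ioc_disjoint_Ioi le_rfl) measurableSet_Ioi
      (integrableOn_kernel_self_Ioc (c := c) (a := a) (z := z) hn j x (f j)) (integrableOn_kernel_self_Ioi hn hc hz j hx (f j))
    rw [Ioc_union_Ioi_eq_Ioi hx] at hun
    rw [hun, intervalIntegral.integral_of_le hx, ← integral_const_mul, ← integral_const_mul]
    congr 1
    · refine setIntegral_congr_fun measurableSet_Ioc fun x' hx' => ?_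
      simp only [kernel_self_of_le hn hx'.2, mul_assoc, hE]
    · refine setIntegral_congr_fun measurableSet_Ioi fun x' hx' => ?_
      simp only [kernel_self_of_lt hn hx', mul_assoc]
  rw [hrep.integral_mul hf (hasDerivAt_genEig_self _ j) (hasDerivAt_genEigDeriv _ j) le_rfl hx,
    hrep.integral_Ioi_cexp_mul hf (hκ j) (decayExp_sq j) hx, ← hE, genEig_self_zero] at hself
  have hdet := mul_wronskian_det_eq (hc j).ne' hξ x
  rw [← hE] at hdet
  have hD0 := mul_genEigDeriv_zero (hc j).ne' hξ
  have hT := t1.2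
  rw [← Finset.add_sum_erase _ _ (Finset.mem_univ j)] at hT ⊢
  rw [Finset.sum_congr rfl hother, ← Finset.mul_sum, Finset.sum_add_distrib, Finset.sum_neg_distrib,
    ← Finset.mul_sum, hself]
  field_simp
  -- The terms in `vⱼ'(x)` have cancelled. `hdet` evaluates the coefficient of `vⱼ(x)`, `hD0`
  -- removes the vertex value, and `hT` the vertex derivatives.
  linear_combination (-v j x) * hdet + (-E * v j 0) * hD0 + E * hT

end

end StarNetwork

end

theorem theorem3p8 (n : ℕ) (hn : 2 ≤ n) (c a : Fin n → ℝ)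
    (hc : ∀ k, 0 < c k) (ha : ∀ k, 0 ≤ a k) (hmono : Monotone a)
    (f : StarNetwork.NetL2 n) (z : ℂ)
    (hz : z ∈ StarNetwork.resolventSet (StarNetwork.opA c a))
    (hre : a ⟨0, by omega⟩ ≤ z.re) :
    (StarNetwork.wronskian c a z ≠ 0 ∧ ∀ k, StarNetwork.xi c a k z ≠ 0) ∧
    (∀ (j : Fin n) (x : ℝ), 0 ≤ x → ∀ k : Fin n,
      IntegrableOn (fun x' => StarNetwork.kernel c a z j x k x' * f k x') (Ioi 0)) ∧
    ∃ u : Fin n → ℝ → ℂ,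
      StarNetwork.Represents u (StarNetwork.resolvent z (StarNetwork.opA c a) f) ∧
      StarNetwork.T0 u ∧
      ∀ (j : Fin n) (x : ℝ), 0 ≤ x →
        u j x = ∑ k : Fin n, ∫ x' in Ioi (0 : ℝ), StarNetwork.kernel c a z j x k x' * f k x' := by
  have him : z.im ≠ 0 := StarNetwork.im_ne_zero_of_mem_resolventSet (hc _) hz hre
  refine ⟨⟨StarNetwork.wronskian_ne_zero (by omega) hc him, StarNetwork.xi_ne_zero hc him⟩,
    fun j x hx k => StarNetwork.integrableOn_kernel hn hc him j hx k (f k), ?_⟩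
  obtain ⟨v, hv, t0, t1, H⟩ := StarNetwork.exists_rep_resolvent hc hz f
  exact ⟨v, hv, t0, fun j x hx => StarNetwork.eq_sum_integral_kernel hn hc him t0 t1 H j hx⟩
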